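/- **Model.** Fix $d\ge 1$, $\gamma\in(1,\infty]$, $\tau\in(2,3)$ and $C,w_0>0$. Put $\mu=w_0\frac{\tau-1}{\tau-2}$ and $C_1=(1+(\gamma-1)^{-1})2^d$ (so $C_1=2^d$ if $\gamma=\infty$). For each $n$ let $V=\{1,\dots,n\}$, let $1\le k=k_n\le n$, let $V_C=\{1,\dots,k\}$ (the planted community), and let $(w_i)_{i\in V}=(w_i^{(n)})_{i\in V}$ be deterministic positive weights. Let $F_n(x)=\frac1n\sum_{i\in V}1\{w_i\le x\}$ and $F_k(x)=\frac1k\sum_{i\in V_C}1\{w_i\le x\}$. Assume that, as $n\to\infty$, 1. $1-F_n(x)=Cx^{1-\tau}(1+o(1))$, uniformly over $w_0\le x\le n^{1/(\tau-1)}/\log n$; 2. for every $K>0$, $1-F_k(x)=Cx^{1-\tau}(1+o(1))$, uniformly over $w_0\le x\le K\,k^{1/(\tau-1)}/\log k$; 3. $\max_{i\in V}w_i\le n^{1/(\tau-1)+o(1)}$ and $\max_{i\in V_C}w_i\le k^{1/(\tau-1)+o(1)}$. Let the positions $(x_i)_{i\in V_C}$ be independent and uniform on the torus $(\mathbb R/\mathbb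 Z)^d$, and let $\|\cdot\|$ be the supremum over the coordinates of the distance on the circle $\mathbb R/\mathbb Z$. Given the positions, $G$ is the simple random graph on $V$ in which the edges $\{i,j\}$ are present independently, with probability $$p_{ij}=\frac{1}{1+C_1}\min\Big(\frac{w_iw_j}{\mu k\|x_i-x_j\|^d},1\Big)^{\gamma}\ \text{ if } i,j\in V_C,\qquad p_{ij}=\frac{1}{1+C_1}\min\Big(\frac{w_iw_j}{\mu n},1\Big)\ \text{ otherwise;}$$ for $\gamma=\infty$ the first expression means $\frac1{1+C_1}1\{\|x_i-x_j\|^d\le w_iw_j/(\mu k)\}$. **Theorem.** For $a\in V$ let $$W(a)=\frac{n}{w_a^2}\sum_{b,c\in V}\frac{1}{w_bw_c}\,1\{a,b,c\text{ form a triangle of }G\},\qquad T(a)=1\Big\{W(a)>\frac{n}{w_a\sqrt{\log n}}\Big\},$$ let $\hat V_C=\{a\in V:T(a)=1\}$, and for $U\subseteq V$ and $h>0$ let $U^h=\{a\in U:w_a\ge h\}$. Let $t_n>0$ satisfy $$\Big(\frac{n\log n}{k}\Big)^{1/\tau}\ll t_n\ll k^{1/(\tau-1)},$$ where $f\ll g$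 means $f=o(g)$ as $n\to\infty$. Then, as $n\to\infty$ along those $n$ for which $V_C^{t_n}\neq\emptyset$, $$\mathbb E\left[\frac{|\hat V_C^{t_n}\,\triangle\,V_C^{t_n}|}{2\,|V_C^{t_n}|}\right]\longrightarrow 0 .$$ -/

import Mathlib

open Filter Topology MeasureTheory Asymptotics
open scoped ENNReal

noncomputable section

namespace GeomCommunity

/-- The planted community `V_C` (the type-B vertices): the first `k` of the `n` vertices. -/
def community (n k : ℕ) : Finset (Fin n) := Finset.univ.filter fun i => i.val < k

/-- The empirical weight distribution function of the vertices in `S`: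
`x ↦ |S|⁻¹ ∑_{i ∈ S} 1{w i ≤ x}`. -/
def empCDF {n : ℕ} (S : Finset (Fin n)) (w : Fin n → ℝ) (x : ℝ) : ℝ :=
  ((S.filter fun i => w i ≤ x).card : ℝ) / (S.card : ℝ)

/-- The constant `μ = w₀ (τ - 1) / (τ - 2)`. -/
def meanWeight (τ w₀ : ℝ) : ℝ := w₀ * (τ - 1) / (τ - 2)

/-- The correction constant `C₁ = (1 + (γ - 1)⁻¹) 2 ^ d`; for `γ = ∞` it equals `2 ^ d`. -/
def corrConst (d : ℕ) (γ : ℝ≥0∞) : ℝ := (1 + ((γ - 1)⁻¹).toReal) * 2 ^ d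

/-- The geometric connection profile `min (s / r, 1) ^ γ`, with `s = w_i w_j / (μ k)` and
`r = ‖x_i - x_j‖ ^ d`. It is `1` when `r ≤ s` (in particular when `r = 0 < s`); when `r > s` it is
`(s / r) ^ γ`, which for `γ = ∞` is `0` (the threshold rule). -/
def geomProfile (γ : ℝ≥0∞) (s r : ℝ) : ℝ :=
  if r ≤ s then 1 else if γ = ⊤ then 0 else (s / r) ^ γ.toReal

/-- The probability of the edge `{i, j}` under the alternative hypothesis, given the positions `x`
on the torus `UnitAddTorus (Fin d) = (ℝ / ℤ) ^ d`, whose norm is the supremum over the coordinates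
of the distance on the circle `ℝ / ℤ`. Only the positions of the vertices in the community
matter. -/
def edgeProb (d : ℕ) (τ w₀ : ℝ) (γ : ℝ≥0∞) {n : ℕ} (k : ℕ) (w : Fin n → ℝ)
    (x : Fin n → UnitAddTorus (Fin d)) (i j : Fin n) : ℝ :=
  1 / (1 + corrConst d γ) *
    (if i ∈ community n k ∧ j ∈ community n k then
      geomProfile γ (w i * w j / (meanWeight τ w₀ * k)) (‖x i - x j‖ ^ d)
    else min (w i * w j / (meanWeight τ w₀ * n)) 1)

theorem edgeProb_comm (d : ℕ) (τ w₀ : ℝ) (γ : ℝ≥0∞) {n : ℕ} (k : ℕ) (w : Fin n → ℝ)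
    (x : Fin n → UnitAddTorus (Fin d)) (i j : Fin n) :
    edgeProb d τ w₀ γ k w x i j = edgeProb d τ w₀ γ k w x j i := by
  unfold edgeProb
  simp only [mul_comm (w i) (w j), norm_sub_rev (x i) (x j), and_comm]

/-- The sample space of the alternative model: a position on the torus for every vertex and a
number in `[0, 1]` for every pair of vertices. Its measure `volume` is the product of the uniform
probability measures, so all these coordinates are independent and uniform. -/
abbrev Sample (d n : ℕ) : Type :=
  (Fin n → UnitAddTorus (Fin d)) × (Sym2 (Fin n) → unitInterval)

/-- The random graph of the alternative hypothesis: the edge `{i, j}` is present when the uniform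
variable of the pair is below the edge probability. Hence, given the positions, distinct edges
are independent, and `{i, j}` is present with probability `edgeProb d τ w₀ γ k w x i j`. -/
def randomGraph (d : ℕ) (τ w₀ : ℝ) (γ : ℝ≥0∞) {n : ℕ} (k : ℕ) (w : Fin n → ℝ)
    (ω : Sample d n) : SimpleGraph (Fin n) where
  Adj i j := i ≠ j ∧ (ω.2 s(i, j) : ℝ) < edgeProb d τ w₀ γ k w ω.1 i j
  symm := ⟨fun i j h => ⟨h.1.symm, by
    rw [Sym2.eq_swap, edgeProb_comm]
    exact h.2⟩⟩
  loopless := ⟨fun _ h => h.1 rfl⟩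

open Classical in
/-- The local triangle statistic
`W(a) = n / w_a ^ 2 * ∑_{b, c} 1{a, b, c form a triangle of G} / (w_b w_c)`,
the sum running over all ordered pairs of vertices. -/
def localTriangles {n : ℕ} (w : Fin n → ℝ) (G : SimpleGraph (Fin n)) (a : Fin n) : ℝ :=
  (n : ℝ) / w a ^ 2 *
    ∑ b : Fin n, ∑ c : Fin n, if G.Adj a b ∧ G.Adj b c ∧ G.Adj c a then 1 / (w b * w c) else 0

/-- The estimated community `{a | T(a) = 1}`, where `T(a) = 1{W(a) > n / (w_a √(log n))}`. -/
def estimatedCommunity {n : ℕ} (w : Fin n → ℝ) (G : SimpleGraph (Fin n)) : Finset (Fin n) :=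
  Finset.univ.filter fun a =>
    localTriangles w G a > (n : ℝ) / (w a * Real.sqrt (Real.log n))

/-- The set `U ^ h` of the vertices of `U` with weight at least `h`. -/
def heavy {n : ℕ} (w : Fin n → ℝ) (U : Finset (Fin n)) (h : ℝ) : Finset (Fin n) :=
  U.filter fun a => w a ≥ h

/-- The expected normalized symmetric difference, under the alternative hypothesis, between the
estimated community and the community, both restricted to the vertices of weight at least `t`. -/
def risk (d : ℕ) (τ w₀ : ℝ) (γ : ℝ≥0∞) {n : ℕ} (k : ℕ) (w : Fin n → ℝ) (t : ℝ) : ℝ :=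
  ∫ ω : Sample d n,
    ((symmDiff (heavy w (estimatedCommunity w (randomGraph d τ w₀ γ k w ω)) t)
        (heavy w (community n k) t)).card : ℝ) /
      (2 * ((heavy w (community n k) t).card : ℝ))

end GeomCommunity

end

/-!
Outside the community the expected value of `W(a)` is bounded, because `C₁` normalises the mean
edge probability over the uniform positions; so by Markov's inequality a vertex is wrongly reported
with probability `O(w_a √(log n) / n)`. Inside, `W(a)` is bounded below by counting the pairs
`(b, c)` of light vertices with `b` close to `a` and `c` close to `b`, at the scales that force the
three edge probabilities up to the factor `1 / (1 + C₁)`. This count has mean of order `w_a`, and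
the second moment method shows that `a` is missed with probability `O(1 / w_a)`. Finally, the
power laws bound the total weight of the heavy vertices by `O(n / log n)` per heavy vertex of the
community, so that the wrong reports outside are negligible as well.
-/

namespace GeomCommunity

/-! ### Positions on the torus -/

instance : IsProbabilityMeasure (volume : Measure UnitAddCircle) :=
  ⟨by simp [AddCircle.measure_univ]⟩

theorem lintegral_update {ι : Type*} [Fintype ι] [DecidableEq ι] {X : ι → Type*}
    [∀ i, MeasurableSpace (X i)] (μ : ∀ i, Measure (X i)) [∀ i, IsProbabilityMeasure (μ i)]
    (i : ι) {f : (∀ i, X i) → ℝ≥0∞} (hf : Measurable f) :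
    ∫⁻ x, ∫⁻ y, f (Function.update x i y) ∂μ i ∂Measure.pi μ = ∫⁻ x, f x ∂Measure.pi μ := by
  rw [← lmarginal_singleton (μ := μ) f i]
  refine lintegral_eq_of_lmarginal_eq {i} (hf.lmarginal μ) hf ?_
  rw [lmarginal_singleton (μ := μ) (∫⋯∫⁻_{i}, f ∂μ) i]
  funext x
  simp [lmarginal_update_of_mem]

theorem volume_norm_pow_le {d : ℕ} (hd : d ≠ 0) {s : ℝ} (hs : 0 ≤ s) :
    volume {y : UnitAddTorus (Fin d) | ‖y‖ ^ d ≤ s / 2 ^ d} = ENNReal.ofReal (min 1 s) := by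
  obtain ⟨r, hr, rfl⟩ : ∃ r : ℝ, 0 ≤ r ∧ s = (2 * r) ^ d :=
    ⟨s ^ (d : ℝ)⁻¹ / 2, by positivity, by
      rw [mul_div_cancel₀ _ two_ne_zero, Real.rpow_inv_natCast_pow hs hd]⟩
  have hball : {y : UnitAddTorus (Fin d) | ‖y‖ ^ d ≤ (2 * r) ^ d / 2 ^ d}
      = Metric.closedBall 0 r := by
    ext y
    simp only [Set.mem_ofPred_eq, Metric.mem_closedBall, dist_zero_right, ← div_pow,
      mul_div_cancel_left₀ r two_ne_zero]
    exact pow_le_pow_iff_left₀ (norm_nonneg y) hr hd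
  rw [hball, volume_pi_closedBall 0 hr]
  simp only [AddCircle.volume_closedBall, Finset.prod_const, Finset.card_univ, Fintype.card_fin]
  rw [← ENNReal.ofReal_pow (by positivity), ← one_pow d,
    ← pow_left_monotoneOn.map_min (zero_le_one' ℝ) (by positivity : 0 ≤ 2 * r), one_pow]

section Near

variable {d : ℕ} {ι : Type*}

theorem measurable_norm_sub_pow (i j : ι) :
    Measurable fun x : ι → UnitAddTorus (Fin d) => ‖x i - x j‖ ^ d := by
  fun_prop

/-- The event that the positions of `i` and `j` are close to each other. The radius is chosen so
that this event has probability `s` for `0 ≤ s ≤ 1`. -/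
def near (i j : ι) (s : ℝ) : Set (ι → UnitAddTorus (Fin d)) :=
  {x | ‖x i - x j‖ ^ d ≤ s / 2 ^ d}

theorem near_comm (i j : ι) (s : ℝ) : near (d := d) i j s = near j i s := by
  simp only [near, norm_sub_rev]

theorem measurableSet_near (i j : ι) (s : ℝ) : MeasurableSet (near (d := d) i j s) :=
  measurableSet_le (measurable_norm_sub_pow i j) measurable_const

theorem update_mem_near [DecidableEq ι] {i j l : ι} (hi : i ≠ l) (hj : j ≠ l) (s : ℝ)
    (x : ι → UnitAddTorus (Fin d)) (y : UnitAddTorus (Fin d)) :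
    Function.update x l y ∈ near i j s ↔ x ∈ near i j s := by
  simp [near, Function.update_of_ne hi, Function.update_of_ne hj]

theorem lintegral_mul_comp_sub [DecidableEq ι] [Fintype ι] {i j : ι} (hij : i ≠ j)
    {f : (ι → UnitAddTorus (Fin d)) → ℝ≥0∞} (hf : Measurable f)
    (hfi : ∀ x y, f (Function.update x i y) = f x)
    {g : UnitAddTorus (Fin d) → ℝ≥0∞} (hg : Measurable g) :
    ∫⁻ x, f x * g (x i - x j) = (∫⁻ x, f x) * ∫⁻ y, g y := by
  have : (volume : Measure (UnitAddTorus (Fin d))).IsAddHaarMeasure :=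
    inferInstanceAs (Measure.pi fun _ : Fin d => (volume : Measure UnitAddCircle)).IsAddHaarMeasure
  have hsub : Measurable fun x : ι → UnitAddTorus (Fin d) => x i - x j := by fun_prop
  rw [← lintegral_mul_const _ hf, volume_pi]
  refine (lintegral_update _ i (hf.mul (hg.comp hsub))).symm.trans (lintegral_congr fun x => ?_)
  simp only [Function.comp_def, Pi.mul_apply, hfi, Function.update_self,
    Function.update_of_ne hij.symm]
  exact (lintegral_const_mul _ (hg.comp (measurable_id.sub_const _))).trans
    (congrArg _ (lintegral_sub_right_eq_self g (x j)))

theorem measureReal_inter_near [DecidableEq ι] [Fintype ι] (hd : d ≠ 0) {i j : ι} (hij : i ≠ j)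
    {s : ℝ} (hs : s ∈ Set.Icc 0 1) {A : Set (ι → UnitAddTorus (Fin d))} (hA : MeasurableSet A)
    (hAi : ∀ x y, Function.update x i y ∈ A ↔ x ∈ A) :
    volume.real (A ∩ near i j s) = volume.real A * s := by
  set D : Set (UnitAddTorus (Fin d)) := {y | ‖y‖ ^ d ≤ s / 2 ^ d} with hD
  have hDm : MeasurableSet D := measurableSet_le (by fun_prop) measurable_const
  have h := lintegral_mul_comp_sub hij (measurable_one.indicator hA)
    (fun x y => by by_cases hx : x ∈ A <;> simp [Set.indicator, hAi, hx])
    (measurable_one.indicator hDm)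
  have hprod (x : ι → UnitAddTorus (Fin d)) :
      A.indicator 1 x * D.indicator 1 (x i - x j) = (A ∩ near i j s).indicator (M := ℝ≥0∞) 1 x :=
    (congrFun (Set.inter_indicator_one (s := A) (t := near i j s) (M₀ := ℝ≥0∞)) x).symm
  simp only [hprod] at h
  rw [lintegral_indicator_one (hA.inter (measurableSet_near i j s)), lintegral_indicator_one hA,
    lintegral_indicator_one hDm, hD, volume_norm_pow_le hd hs.1, min_eq_right hs.2] at h
  rw [measureReal_def, h, ENNReal.toReal_mul, ENNReal.toReal_ofReal hs.1, measureReal_def]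

end Near

theorem volume_forall_lt {ι : Type*} [Fintype ι] (S : Finset ι) {p : ι → ℝ}
    (hp₀ : ∀ e ∈ S, 0 ≤ p e) (hp₁ : ∀ e ∈ S, p e ≤ 1) :
    volume {u : ι → unitInterval | ∀ e ∈ S, (u e : ℝ) < p e} = ∏ e ∈ S, ENNReal.ofReal (p e) := by
  classical
  have hpi : {u : ι → unitInterval | ∀ e ∈ S, (u e : ℝ) < p e}
      = Set.univ.pi fun e => if e ∈ S then {v : unitInterval | (v : ℝ) < p e} else Set.univ := by
    ext u
    simp only [Set.mem_ofPred_eq, Set.mem_pi, Set.mem_univ, forall_const]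
    refine forall_congr' fun e => ?_
    by_cases he : e ∈ S <;> simp [he]
  rw [hpi, volume_pi, Measure.pi_pi, ← Finset.prod_subset (Finset.subset_univ S)]
  · refine Finset.prod_congr rfl fun e he => ?_
    rw [if_pos he]
    exact unitInterval.volume_Iio ⟨p e, hp₀ e he, hp₁ e he⟩
  · intro e _ he
    rw [if_neg he]
    exact measure_univ

/-! ### Connection probabilities -/

theorem meanWeight_pos {τ w₀ : ℝ} (hτ : 2 < τ) (hw₀ : 0 < w₀) : 0 < meanWeight τ w₀ :=
  div_pos (mul_pos hw₀ (by linarith)) (by linarith)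

theorem corrConst_nonneg (d : ℕ) (γ : ℝ≥0∞) : 0 ≤ corrConst d γ := by
  unfold corrConst
  positivity

theorem inv_toReal_lt_one {γ : ℝ≥0∞} (hγ : 1 < γ) : γ.toReal⁻¹ < 1 := by
  rcases eq_or_ne γ ⊤ with rfl | hγ'
  · simp
  · exact inv_lt_one_of_one_lt₀ (by simpa using (ENNReal.toReal_lt_toReal (by simp) hγ').2 hγ)

theorem corrConst_eq_div (d : ℕ) {γ : ℝ≥0∞} (hγ : 1 < γ) :
    corrConst d γ = 2 ^ d / (1 - γ.toReal⁻¹) := by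
  rcases eq_or_ne γ ⊤ with rfl | hγ'
  · simp [corrConst]
  · have h1 : 1 < γ.toReal := by simpa using (ENNReal.toReal_lt_toReal (by simp) hγ').2 hγ
    have h2 : γ.toReal - 1 ≠ 0 := by linarith
    have h3 : 1 - γ.toReal⁻¹ ≠ 0 := by linarith [inv_toReal_lt_one hγ]
    rw [corrConst, ENNReal.toReal_inv, ENNReal.toReal_sub_of_le hγ.le hγ', ENNReal.toReal_one,
      eq_div_iff h3]
    field_simp
    ring

/-- The factor `1 / (1 + C₁)` by which all the edges are thinned. -/
noncomputable def retention (d : ℕ) (γ : ℝ≥0∞) : ℝ := 1 / (1 + corrConst d γ)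

theorem retention_pos (d : ℕ) (γ : ℝ≥0∞) : 0 < retention d γ :=
  one_div_pos.2 (add_pos_of_pos_of_nonneg one_pos (corrConst_nonneg d γ))

theorem retention_le_one (d : ℕ) (γ : ℝ≥0∞) : retention d γ ≤ 1 := by
  have := corrConst_nonneg d γ
  exact (div_le_one (by linarith)).2 (by linarith)

theorem retention_mul_corrConst_le_one (d : ℕ) (γ : ℝ≥0∞) : retention d γ * corrConst d γ ≤ 1 := by
  have := corrConst_nonneg d γ
  rw [retention, one_div_mul_eq_div]
  exact (div_le_one (by linarith)).2 (by linarith)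

section Profile

variable {γ : ℝ≥0∞} {s r u : ℝ}

theorem geomProfile_of_le (γ : ℝ≥0∞) (h : r ≤ s) : geomProfile γ s r = 1 := if_pos h

theorem geomProfile_mem_Icc (γ : ℝ≥0∞) (hs : 0 ≤ s) (hr : 0 ≤ r) :
    geomProfile γ s r ∈ Set.Icc (0 : ℝ) 1 := by
  unfold geomProfile
  split_ifs with h1 h2
  · simp
  · simp
  · exact ⟨by positivity, Real.rpow_le_one (by positivity) (div_le_one_of_le₀ (not_le.1 h1).le hr)
      ENNReal.toReal_nonneg⟩

theorem measurable_geomProfile (γ : ℝ≥0∞) (s : ℝ) : Measurable (geomProfile γ s) := by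
  unfold geomProfile
  refine Measurable.ite (measurableSet_le measurable_id measurable_const) measurable_const ?_
  split_ifs <;> fun_prop

theorem le_of_lt_geomProfile (hγ : γ ≠ 0) (hs : 0 < s) (hu : 0 < u) (h : u < geomProfile γ s r) :
    r ≤ s * u ^ (-γ.toReal⁻¹) := by
  unfold geomProfile at h
  split_ifs at h with h1 h2
  · exact h1.trans (le_mul_of_one_le_right hs.le
      (Real.one_le_rpow_of_pos_of_le_one_of_nonpos hu h.le (by simp)))
  · linarith
  · have hr : 0 < r := hs.trans (not_le.1 h1)
    have hg : 0 < γ.toReal := ENNReal.toReal_pos hγ h2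
    have h3 : u ^ γ.toReal⁻¹ < s / r :=
      (Real.rpow_inv_lt_iff_of_pos hu.le (by positivity) hg).2 h
    rw [Real.rpow_neg hu.le, ← div_eq_mul_inv, le_div_iff₀ (by positivity), mul_comm]
    exact ((lt_div_iff₀ hr).1 h3).le

theorem volume_lt_geomProfile_le {d : ℕ} (hd : d ≠ 0) (hγ : γ ≠ 0) (hs : 0 < s) (hu : 0 < u) :
    volume {y : UnitAddTorus (Fin d) | u < geomProfile γ s (‖y‖ ^ d)} ≤
      (Set.Ioc (0 : ℝ) 1).indicator
        (fun u => ENNReal.ofReal (2 ^ d * s * u ^ (-γ.toReal⁻¹))) u := by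
  by_cases h1 : u ≤ 1
  · rw [Set.indicator_of_mem (Set.mem_Ioc.2 ⟨hu, h1⟩)]
    refine (measure_mono fun y hy => ?_).trans
      ((volume_norm_pow_le hd (s := 2 ^ d * s * u ^ (-γ.toReal⁻¹)) (by positivity)).trans_le
        (ENNReal.ofReal_le_ofReal (min_le_right _ _)))
    rw [Set.mem_ofPred_eq, mul_assoc, mul_div_cancel_left₀ _ (by positivity)]
    exact le_of_lt_geomProfile hγ hs hu hy
  · have hempty : {y : UnitAddTorus (Fin d) | u < geomProfile γ s (‖y‖ ^ d)} = ∅ :=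
      Set.eq_empty_of_forall_notMem fun y hy =>
        h1 (hy.le.trans (geomProfile_mem_Icc γ hs.le (by positivity)).2)
    simp [hempty]

theorem lintegral_Ioc_rpow_neg {e : ℝ} (he : e < 1) :
    ∫⁻ u in Set.Ioc (0 : ℝ) 1, ENNReal.ofReal (u ^ (-e)) = ENNReal.ofReal (1 / (1 - e)) := by
  have hint : IntegrableOn (fun u : ℝ => u ^ (-e)) (Set.Ioc 0 1) :=
    (intervalIntegrable_iff_integrableOn_Ioc_of_le zero_le_one).1
      (intervalIntegral.intervalIntegrable_rpow' (by linarith))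
  rw [← ofReal_integral_eq_lintegral_ofReal hint ((ae_restrict_iff' measurableSet_Ioc).2
    (.of_forall fun u hu => Real.rpow_nonneg hu.1.le _)),
    ← intervalIntegral.integral_of_le zero_le_one, integral_rpow (.inl (by linarith)),
    Real.one_rpow, Real.zero_rpow (by linarith), sub_zero, neg_add_eq_sub]

theorem lintegral_geomProfile_le {d : ℕ} (hd : d ≠ 0) (hγ : 1 < γ) (hs : 0 < s) :
    ∫⁻ y : UnitAddTorus (Fin d), ENNReal.ofReal (geomProfile γ s (‖y‖ ^ d))
      ≤ ENNReal.ofReal (corrConst d γ * s) := by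
  rw [lintegral_eq_lintegral_meas_lt volume
    (.of_forall fun y => (geomProfile_mem_Icc γ hs.le (by positivity)).1)
    ((measurable_geomProfile γ s).comp (by fun_prop)).aemeasurable]
  refine (setLIntegral_mono' measurableSet_Ioi fun u hu =>
    volume_lt_geomProfile_le hd (zero_lt_one.trans hγ).ne' hs hu).trans (le_of_eq ?_)
  rw [lintegral_indicator measurableSet_Ioc, Measure.restrict_restrict measurableSet_Ioc,
    Set.inter_eq_left.2 fun u hu => hu.1]
  simp only [ENNReal.ofReal_mul (show (0 : ℝ) ≤ 2 ^ d * s by positivity)]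
  rw [lintegral_const_mul _ (by fun_prop), lintegral_Ioc_rpow_neg (inv_toReal_lt_one hγ),
    ← ENNReal.ofReal_mul (by positivity), corrConst_eq_div d hγ]
  congr 1
  ring

end Profile

theorem mem_community {n k : ℕ} {i : Fin n} : i ∈ community n k ↔ i.val < k := by
  simp [community]

section EdgeProb

variable {d n k : ℕ} {γ : ℝ≥0∞} {τ w₀ : ℝ} {w : Fin n → ℝ}

theorem edgeProb_mem_Icc (hμ : 0 < meanWeight τ w₀) (hw : ∀ i, 0 < w i)
    (x : Fin n → UnitAddTorus (Fin d)) (i j : Fin n) :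
    edgeProb d τ w₀ γ k w x i j ∈ Set.Icc (0 : ℝ) 1 := by
  have hi := hw i
  have hj := hw j
  have hfactor : (if i ∈ community n k ∧ j ∈ community n k then
      geomProfile γ (w i * w j / (meanWeight τ w₀ * k)) (‖x i - x j‖ ^ d)
      else min (w i * w j / (meanWeight τ w₀ * n)) 1) ∈ Set.Icc (0 : ℝ) 1 := by
    split_ifs
    · exact geomProfile_mem_Icc γ (by positivity) (by positivity)
    · exact ⟨by positivity, min_le_right _ _⟩
  exact ⟨mul_nonneg (retention_pos d γ).le hfactor.1,
    mul_le_one₀ (retention_le_one d γ) hfactor.1 hfactor.2⟩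

theorem edgeProb_le_of_notMem (hμ : 0 < meanWeight τ w₀) (hw : ∀ i, 0 < w i)
    (x : Fin n → UnitAddTorus (Fin d)) {i j : Fin n}
    (hij : ¬ (i ∈ community n k ∧ j ∈ community n k)) :
    edgeProb d τ w₀ γ k w x i j ≤ w i * w j / (meanWeight τ w₀ * n) := by
  have hi := hw i
  have hj := hw j
  rw [edgeProb, if_neg hij]
  exact (mul_le_of_le_one_left (by positivity) (retention_le_one d γ)).trans (min_le_left _ _)

theorem measurable_edgeProb (i j : Fin n) :
    Measurable fun x : Fin n → UnitAddTorus (Fin d) => edgeProb d τ w₀ γ k w x i j := by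
  unfold edgeProb
  refine Measurable.const_mul ?_ _
  split_ifs
  · exact (measurable_geomProfile γ _).comp (measurable_norm_sub_pow i j)
  · exact measurable_const

/-- `C₁` is the volume constant of the connection profile, so that thinning by `1 / (1 + C₁)` leaves
an edge inside the community with mean probability at most `w_i w_j / (μ k)`. -/
theorem lintegral_edgeProb_le_of_mem (hd : d ≠ 0) (hγ : 1 < γ) (hμ : 0 < meanWeight τ w₀)
    (hw : ∀ i, 0 < w i) {i j : Fin n} (hij : i ≠ j) (hi : i ∈ community n k)
    (hj : j ∈ community n k) :
    ∫⁻ x : Fin n → UnitAddTorus (Fin d), ENNReal.ofReal (edgeProb d τ w₀ γ k w x i j) ≤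
      ENNReal.ofReal (w i * w j / (meanWeight τ w₀ * k)) := by
  have hk : (0 : ℝ) < k := by exact_mod_cast (mem_community.1 hi).pos
  set s := w i * w j / (meanWeight τ w₀ * k)
  have hs : 0 < s := div_pos (mul_pos (hw i) (hw j)) (mul_pos hμ hk)
  have hprofile : Measurable fun y : UnitAddTorus (Fin d) =>
      ENNReal.ofReal (geomProfile γ s (‖y‖ ^ d)) :=
    ((measurable_geomProfile γ s).comp (by fun_prop)).ennreal_ofReal
  calc ∫⁻ x : Fin n → UnitAddTorus (Fin d), ENNReal.ofReal (edgeProb d τ w₀ γ k w x i j)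
      = ∫⁻ x : Fin n → UnitAddTorus (Fin d), ENNReal.ofReal (retention d γ) *
          ENNReal.ofReal (geomProfile γ s (‖x i - x j‖ ^ d)) := by
        simp only [edgeProb, if_pos (And.intro hi hj), ← ENNReal.ofReal_mul (retention_pos d γ).le]
        rfl
    _ = ENNReal.ofReal (retention d γ) *
          ∫⁻ y : UnitAddTorus (Fin d), ENNReal.ofReal (geomProfile γ s (‖y‖ ^ d)) := by
        rw [lintegral_mul_comp_sub hij measurable_const (fun _ _ => rfl) hprofile,
          lintegral_const, measure_univ, mul_one]
    _ ≤ ENNReal.ofReal (retention d γ) * ENNReal.ofReal (corrConst d γ * s) := by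
        gcongr
        exact lintegral_geomProfile_le hd hγ hs
    _ ≤ ENNReal.ofReal s := by
        rw [← ENNReal.ofReal_mul (retention_pos d γ).le, ← mul_assoc]
        exact ENNReal.ofReal_le_ofReal
          (mul_le_of_le_one_left hs.le (retention_mul_corrConst_le_one d γ))

theorem lintegral_edgeProb_le (hd : d ≠ 0) (hγ : 1 < γ) (hμ : 0 < meanWeight τ w₀)
    (hw : ∀ i, 0 < w i) {i j : Fin n} (hij : i ≠ j) :
    ∫⁻ x : Fin n → UnitAddTorus (Fin d), ENNReal.ofReal (edgeProb d τ w₀ γ k w x i j) ≤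
      ENNReal.ofReal (w i * w j / (meanWeight τ w₀ *
        if i ∈ community n k ∧ j ∈ community n k then (k : ℝ) else n)) := by
  split_ifs with h
  · exact lintegral_edgeProb_le_of_mem hd hγ hμ hw hij h.1 h.2
  · refine (lintegral_mono fun x =>
      ENNReal.ofReal_le_ofReal (edgeProb_le_of_notMem hμ hw x h)).trans_eq ?_
    rw [lintegral_const, measure_univ, mul_one]

end EdgeProb

/-! ### Triangles -/

section Triangles

variable {d n k : ℕ} {γ : ℝ≥0∞} {τ w₀ : ℝ} {w : Fin n → ℝ} {a b c : Fin n}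

/-- The three sides of the triangle with vertices `a`, `b` and `c`. -/
def sides (a b c : Fin n) : Finset (Sym2 (Fin n)) := {s(a, b), s(b, c), s(c, a)}

theorem prod_sides {M : Type*} [CommMonoid M] (hab : a ≠ b) (hbc : b ≠ c) (hca : c ≠ a)
    (f : Sym2 (Fin n) → M) : ∏ e ∈ sides a b c, f e = f s(a, b) * (f s(b, c) * f s(c, a)) := by
  rw [sides, Finset.prod_insert (by simp [hab, hbc, hab.symm, hca.symm]),
    Finset.prod_pair (by simp [hbc, hca, hab.symm])]

/-- The event that `a`, `b` and `c` form a triangle of the random graph. -/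
def triangleEvent (d : ℕ) (τ w₀ : ℝ) (γ : ℝ≥0∞) (k : ℕ) (w : Fin n → ℝ) (a b c : Fin n) :
    Set (Sample d n) :=
  {ω | (randomGraph d τ w₀ γ k w ω).Adj a b ∧ (randomGraph d τ w₀ γ k w ω).Adj b c ∧
    (randomGraph d τ w₀ γ k w ω).Adj c a}

theorem measurableSet_adj (a b : Fin n) :
    MeasurableSet {ω : Sample d n | (randomGraph d τ w₀ γ k w ω).Adj a b} :=
  (MeasurableSet.const (a ≠ b)).inter <| measurableSet_lt
    (measurable_subtype_coe.comp ((measurable_pi_apply s(a, b)).comp measurable_snd))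
    ((measurable_edgeProb a b).comp measurable_fst)

theorem measurableSet_triangleEvent (a b c : Fin n) :
    MeasurableSet (triangleEvent d τ w₀ γ k w a b c) :=
  (measurableSet_adj a b).inter ((measurableSet_adj b c).inter (measurableSet_adj c a))

theorem volume_triangleEvent (hμ : 0 < meanWeight τ w₀) (hw : ∀ i, 0 < w i)
    (hab : a ≠ b) (hbc : b ≠ c) (hca : c ≠ a) :
    volume (triangleEvent d τ w₀ γ k w a b c) =
      ∫⁻ x : Fin n → UnitAddTorus (Fin d), ENNReal.ofReal (edgeProb d τ w₀ γ k w x a b) *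
        (ENNReal.ofReal (edgeProb d τ w₀ γ k w x b c) *
          ENNReal.ofReal (edgeProb d τ w₀ γ k w x c a)) := by
  rw [Measure.volume_eq_prod, Measure.prod_apply (measurableSet_triangleEvent a b c)]
  refine lintegral_congr fun x => ?_
  let p : Sym2 (Fin n) → ℝ :=
    Sym2.lift ⟨fun i j => edgeProb d τ w₀ γ k w x i j, edgeProb_comm d τ w₀ γ k w x⟩
  have hp (e : Sym2 (Fin n)) : p e ∈ Set.Icc (0 : ℝ) 1 := by
    induction e with | _ i j => exact edgeProb_mem_Icc hμ hw x i j
  have hfibre : Prod.mk x ⁻¹' triangleEvent d τ w₀ γ k w a b c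
      = {u | ∀ e ∈ sides a b c, (u e : ℝ) < p e} := by
    ext u
    simp [triangleEvent, randomGraph, sides, hab, hbc, hca, p]
  rw [hfibre, volume_forall_lt _ (fun e _ => (hp e).1) fun e _ => (hp e).2,
    prod_sides hab hbc hca]
  rfl

theorem triangleEvent_eq_empty (h : ¬ (a ≠ b ∧ b ≠ c ∧ c ≠ a)) :
    triangleEvent d τ w₀ γ k w a b c = ∅ :=
  Set.eq_empty_of_forall_notMem fun _ hω => h ⟨hω.1.ne, hω.2.1.ne, hω.2.2.ne⟩

theorem measureReal_triangleEvent_le (hd : d ≠ 0) (hγ : 1 < γ) (hμ : 0 < meanWeight τ w₀)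
    (hw : ∀ i, 0 < w i) (ha : a ∉ community n k) (b c : Fin n) :
    volume.real (triangleEvent d τ w₀ γ k w a b c) ≤
      w a * w b / (meanWeight τ w₀ * n) * (w b * w c / (meanWeight τ w₀ *
        if b ∈ community n k ∧ c ∈ community n k then (k : ℝ) else n) *
        (w c * w a / (meanWeight τ w₀ * n))) := by
  have hwa := hw a
  have hwb := hw b
  have hwc := hw c
  by_cases h : a ≠ b ∧ b ≠ c ∧ c ≠ a
  · refine ENNReal.toReal_le_of_le_ofReal (by positivity) ?_
    rw [volume_triangleEvent hμ hw h.1 h.2.1 h.2.2, ENNReal.ofReal_mul (by positivity),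
      ENNReal.ofReal_mul (by positivity)]
    calc ∫⁻ x : Fin n → UnitAddTorus (Fin d), ENNReal.ofReal (edgeProb d τ w₀ γ k w x a b) *
          (ENNReal.ofReal (edgeProb d τ w₀ γ k w x b c) *
            ENNReal.ofReal (edgeProb d τ w₀ γ k w x c a))
        ≤ ∫⁻ x : Fin n → UnitAddTorus (Fin d),
            ENNReal.ofReal (w a * w b / (meanWeight τ w₀ * n)) *
              (ENNReal.ofReal (edgeProb d τ w₀ γ k w x b c) *
                ENNReal.ofReal (w c * w a / (meanWeight τ w₀ * n))) := by
          gcongr with x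
          · exact edgeProb_le_of_notMem hμ hw x fun h => ha h.1
          · exact edgeProb_le_of_notMem hμ hw x fun h => ha h.2
      _ ≤ _ := by
          rw [lintegral_const_mul _ ((measurable_edgeProb b c).ennreal_ofReal.mul_const _),
            lintegral_mul_const _ (measurable_edgeProb b c).ennreal_ofReal]
          gcongr
          exact lintegral_edgeProb_le hd hγ hμ hw h.2.1
  · rw [triangleEvent_eq_empty h, measureReal_empty]
    positivity

end Triangles

/-! ### Vertices outside the community -/

section Detection

variable {d n k : ℕ} {γ : ℝ≥0∞} {τ w₀ : ℝ} {w : Fin n → ℝ} {a : Fin n}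

theorem localTriangles_eq_sum_indicator (ω : Sample d n) (a : Fin n) :
    localTriangles w (randomGraph d τ w₀ γ k w ω) a = n / w a ^ 2 * ∑ b, ∑ c,
      (triangleEvent d τ w₀ γ k w a b c).indicator (fun _ => 1 / (w b * w c)) ω := by
  simp only [localTriangles, Set.indicator, triangleEvent, Set.mem_ofPred_eq]
  refine congrArg _ (Finset.sum_congr rfl fun b _ => Finset.sum_congr rfl fun c _ => ?_)
  split_ifs with h <;> simp [h]

theorem integrable_triangleEvent_indicator (a b c : Fin n) (r : ℝ) :
    Integrable ((triangleEvent d τ w₀ γ k w a b c).indicator fun _ => r) :=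
  (integrable_const r).indicator (measurableSet_triangleEvent a b c)

theorem integrable_localTriangles (a : Fin n) :
    Integrable fun ω : Sample d n => localTriangles w (randomGraph d τ w₀ γ k w ω) a := by
  simp only [localTriangles_eq_sum_indicator]
  exact (integrable_finsetSum _ fun b _ => integrable_finsetSum _ fun c _ =>
    integrable_triangleEvent_indicator a b c _).const_mul _

theorem integral_localTriangles (a : Fin n) :
    ∫ ω : Sample d n, localTriangles w (randomGraph d τ w₀ γ k w ω) a = n / w a ^ 2 *
      ∑ b, ∑ c, volume.real (triangleEvent d τ w₀ γ k w a b c) * (1 / (w b * w c)) := by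
  simp only [localTriangles_eq_sum_indicator]
  rw [integral_const_mul, integral_finsetSum _ fun b _ => integrable_finsetSum _ fun c _ =>
    integrable_triangleEvent_indicator a b c _]
  congr! with b
  rw [integral_finsetSum _ fun c _ => integrable_triangleEvent_indicator a b c _]
  congr! with c
  exact integral_indicator_const _ (measurableSet_triangleEvent a b c)

theorem localTriangles_nonneg (hw : ∀ i, 0 < w i) (G : SimpleGraph (Fin n)) (a : Fin n) :
    0 ≤ localTriangles w G a := by
  classical
  refine mul_nonneg (by positivity) (Finset.sum_nonneg fun b _ => Finset.sum_nonneg fun c _ => ?_)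
  have hb := hw b
  have hc := hw c
  split_ifs <;> positivity

/-- The event that the test declares the vertex `a` to lie in the community. -/
def detected (d : ℕ) (τ w₀ : ℝ) (γ : ℝ≥0∞) (k : ℕ) (w : Fin n → ℝ) (a : Fin n) :
    Set (Sample d n) :=
  {ω | a ∈ estimatedCommunity w (randomGraph d τ w₀ γ k w ω)}

theorem mem_detected {ω : Sample d n} : ω ∈ detected d τ w₀ γ k w a ↔
    n / (w a * √(Real.log n)) < localTriangles w (randomGraph d τ w₀ γ k w ω) a := by
  simp [detected, estimatedCommunity]

theorem measurableSet_detected (a : Fin n) : MeasurableSet (detected d τ w₀ γ k w a) := by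
  have hW : Measurable fun ω : Sample d n => localTriangles w (randomGraph d τ w₀ γ k w ω) a := by
    simp only [localTriangles_eq_sum_indicator]
    exact (Finset.measurable_sum _ fun b _ => Finset.measurable_sum _ fun c _ =>
      measurable_const.indicator (measurableSet_triangleEvent a b c)).const_mul _
  have heq : detected d τ w₀ γ k w a = {ω | n / (w a * √(Real.log n)) <
      localTriangles w (randomGraph d τ w₀ γ k w ω) a} := Set.ext fun _ => mem_detected
  exact heq ▸ measurableSet_lt measurable_const hW

theorem sum_mul_div_ite_le {ι : Type*} [Fintype ι] [DecidableEq ι] {w : ι → ℝ}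
    (hw : ∀ i, 0 ≤ w i) (C : Finset ι) {k n M : ℝ} (hk : 0 ≤ k) (hkn : k ≤ n)
    (hV : ∑ i, w i ≤ M * n) (hC : ∑ i ∈ C, w i ≤ M * k) :
    ∑ i, ∑ j, w i * w j / (if i ∈ C ∧ j ∈ C then k else n) ≤ 2 * M ^ 2 * n := by
  have hn : 0 ≤ n := hk.trans hkn
  have hterm (i j : ι) : w i * w j / (if i ∈ C ∧ j ∈ C then k else n) ≤
      (if i ∈ C then if j ∈ C then w i * w j / k else 0 else 0) + w i * w j / n := by
    have hi := hw i
    have hj := hw j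
    have hij : 0 ≤ w i * w j / n := by positivity
    split_ifs <;> simp_all
  have hsq (S : Finset ι) {m : ℝ} (hm : 0 ≤ m) (hS : ∑ i ∈ S, w i ≤ M * m) :
      ∑ i ∈ S, ∑ j ∈ S, w i * w j / m ≤ M ^ 2 * m :=
    calc ∑ i ∈ S, ∑ j ∈ S, w i * w j / m = (∑ i ∈ S, w i) ^ 2 / m := by
          simp only [sq, Finset.sum_mul_sum, Finset.sum_div]
      _ ≤ (M * m) ^ 2 / m := by
          have := Finset.sum_nonneg fun i (_ : i ∈ S) => hw i
          gcongr
      _ = M ^ 2 * (m * m / m) := by ring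
      _ = M ^ 2 * m := by rw [mul_self_div_self]
  calc ∑ i, ∑ j, w i * w j / (if i ∈ C ∧ j ∈ C then k else n)
      ≤ ∑ i, ∑ j, ((if i ∈ C then if j ∈ C then w i * w j / k else 0 else 0) + w i * w j / n) :=
        Finset.sum_le_sum fun i _ => Finset.sum_le_sum fun j _ => hterm i j
    _ = (∑ i ∈ C, ∑ j ∈ C, w i * w j / k) + ∑ i, ∑ j, w i * w j / n := by
        simp [Finset.sum_add_distrib]
    _ ≤ M ^ 2 * k + M ^ 2 * n := add_le_add (hsq C hk hC) (hsq Finset.univ hn hV)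
    _ ≤ 2 * M ^ 2 * n := by nlinarith [sq_nonneg M]

theorem integral_localTriangles_le (hd : d ≠ 0) (hγ : 1 < γ) (hμ : 0 < meanWeight τ w₀)
    (hkn : k ≤ n) (hw : ∀ i, 0 < w i) {M : ℝ} (hV : ∑ i, w i ≤ M * n)
    (hC : ∑ i ∈ community n k, w i ≤ M * k) (ha : a ∉ community n k) :
    ∫ ω : Sample d n, localTriangles w (randomGraph d τ w₀ γ k w ω) a ≤
      2 * M ^ 2 / meanWeight τ w₀ ^ 3 := by
  have hn : (0 : ℝ) < n := by exact_mod_cast a.pos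
  have hwa := hw a
  calc ∫ ω : Sample d n, localTriangles w (randomGraph d τ w₀ γ k w ω) a
      = n / w a ^ 2 *
          ∑ b, ∑ c, volume.real (triangleEvent d τ w₀ γ k w a b c) * (1 / (w b * w c)) :=
        integral_localTriangles a
    _ ≤ n / w a ^ 2 * ∑ b, ∑ c, w a ^ 2 / (meanWeight τ w₀ ^ 3 * n ^ 2) *
          (w b * w c / if b ∈ community n k ∧ c ∈ community n k then (k : ℝ) else n) := by
        refine mul_le_mul_of_nonneg_left (Finset.sum_le_sum fun b _ => Finset.sum_le_sum fun c _ =>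
          ?_) (by positivity)
        have hb := hw b
        have hc := hw c
        refine (mul_le_mul_of_nonneg_right (measureReal_triangleEvent_le hd hγ hμ hw ha b c)
          (one_div_nonneg.2 (mul_pos hb hc).le)).trans_eq ?_
        field_simp
    _ ≤ n / w a ^ 2 * (w a ^ 2 / (meanWeight τ w₀ ^ 3 * n ^ 2) * (2 * M ^ 2 * n)) := by
        simp only [← Finset.mul_sum]
        gcongr
        exact sum_mul_div_ite_le (fun i => (hw i).le) _ k.cast_nonneg (by exact_mod_cast hkn) hV hC
    _ = 2 * M ^ 2 / meanWeight τ w₀ ^ 3 := by field_simp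

theorem measureReal_detected_le_of_notMem (hd : d ≠ 0) (hγ : 1 < γ) (hμ : 0 < meanWeight τ w₀)
    (hn : 1 < n) (hkn : k ≤ n) (hw : ∀ i, 0 < w i) {M : ℝ} (hV : ∑ i, w i ≤ M * n)
    (hC : ∑ i ∈ community n k, w i ≤ M * k) (ha : a ∉ community n k) :
    volume.real (detected d τ w₀ γ k w a) ≤
      2 * M ^ 2 / meanWeight τ w₀ ^ 3 * (w a * √(Real.log n) / n) := by
  have hwa := hw a
  have hlog : 0 < √(Real.log n) := Real.sqrt_pos.2 (Real.log_pos (by exact_mod_cast hn))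
  have hmarkov := mul_meas_ge_le_integral_of_nonneg
    (.of_forall fun ω : Sample d n => localTriangles_nonneg hw (randomGraph d τ w₀ γ k w ω) a)
    (integrable_localTriangles a) (n / (w a * √(Real.log n)))
  rw [← inv_div (n : ℝ), ← div_eq_mul_inv, le_div_iff₀' (by positivity)]
  calc n / (w a * √(Real.log n)) * volume.real (detected d τ w₀ γ k w a)
      ≤ n / (w a * √(Real.log n)) * volume.real {ω : Sample d n |
          n / (w a * √(Real.log n)) ≤ localTriangles w (randomGraph d τ w₀ γ k w ω) a} := by
        exact mul_le_mul_of_nonneg_left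
          (measureReal_mono fun ω hω => (mem_detected.1 hω).le) (by positivity)
    _ ≤ _ := hmarkov.trans (integral_localTriangles_le hd hγ hμ hkn hw hV hC ha)

end Detection

section SecondMoment

open ProbabilityTheory

variable {Ω ι : Type*} [MeasurableSpace Ω] {P : Measure Ω} [IsProbabilityMeasure P]

theorem measureReal_le_half_integral_le {X : Ω → ℝ} (hX : MemLp X 2 P) (hpos : 0 < P[X]) :
    P.real {ω | X ω ≤ P[X] / 2} ≤ 4 * Var[X; P] / P[X] ^ 2 := by
  have hsub : {ω | X ω ≤ P[X] / 2} ⊆ {ω | P[X] / 2 ≤ |X ω - P[X]|} := by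
    intro ω hω
    rw [Set.mem_ofPred_eq] at hω ⊢
    exact le_abs.2 (.inr (by linarith))
  calc P.real {ω | X ω ≤ P[X] / 2}
      ≤ P.real {ω | P[X] / 2 ≤ |X ω - P[X]|} := measureReal_mono hsub
    _ ≤ Var[X; P] / (P[X] / 2) ^ 2 :=
        ENNReal.toReal_le_of_le_ofReal (div_nonneg (variance_nonneg X P) (sq_nonneg _))
          (meas_ge_le_variance_div_sq hX (half_pos hpos))
    _ = 4 * Var[X; P] / P[X] ^ 2 := by field

theorem variance_sum_indicator (S : Finset ι) {A : ι → Set Ω} (hA : ∀ p, MeasurableSet (A p)) :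
    Var[fun ω => ∑ p ∈ S, (A p).indicator 1 ω; P] =
      ∑ p ∈ S, ∑ q ∈ S, (P.real (A p ∩ A q) - P.real (A p) * P.real (A q)) := by
  have hL (p : ι) : MemLp ((A p).indicator 1) 2 P :=
    memLp_indicator_const 2 (hA p) (1 : ℝ) (.inr (measure_ne_top P _))
  rw [← covariance_self (memLp_finsetSum S fun p _ => hL p).aemeasurable,
    covariance_fun_sum_fun_sum' (fun p _ => hL p) fun p _ => hL p]
  refine Finset.sum_congr rfl fun p _ => Finset.sum_congr rfl fun q _ => ?_
  rw [covariance_eq_sub (hL p) (hL q), ← Set.inter_indicator_one,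
    integral_indicator_one ((hA p).inter (hA q)), integral_indicator_one (hA p),
    integral_indicator_one (hA q)]

end SecondMoment

/-! ### Triangles of nearby vertices -/

section ClosePath

variable {d : ℕ} {ι : Type*} {a b c l : ι} {α β : ℝ}

/-- The event that the position of `b` is close to that of `a` and the position of `c` is close to
that of `b`; the two events in the intersection have probabilities `α` and `β`. -/
def closePath (α β : ℝ) (a b c : ι) : Set (ι → UnitAddTorus (Fin d)) :=
  near b a α ∩ near c b β

theorem measurableSet_closePath : MeasurableSet (closePath (d := d) α β a b c) :=
  (measurableSet_near b a α).inter (measurableSet_near c b β)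

theorem norm_sub_pow_le_of_mem_near {i j : ι} {s : ℝ} (hs : 0 ≤ s) {x : ι → UnitAddTorus (Fin d)}
    (hx : x ∈ near i j s) : ‖x i - x j‖ ^ d ≤ s :=
  hx.trans (div_le_self hs (one_le_pow₀ one_le_two))

theorem norm_sub_pow_le_of_mem_closePath (hβα : β ≤ α) {x : ι → UnitAddTorus (Fin d)}
    (hx : x ∈ closePath α β a b c) : ‖x c - x a‖ ^ d ≤ α := by
  have hba : ‖x b - x a‖ ^ d ≤ α / 2 ^ d := hx.1
  have hcb : ‖x c - x b‖ ^ d ≤ α / 2 ^ d :=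
    hx.2.trans (div_le_div_of_nonneg_right hβα (by positivity))
  calc ‖x c - x a‖ ^ d ≤ (2 * max ‖x c - x b‖ ‖x b - x a‖) ^ d := by
        gcongr
        rw [two_mul]
        exact (norm_sub_le_norm_sub_add_norm_sub _ _ _).trans
          (add_le_add (le_max_left _ _) (le_max_right _ _))
    _ = 2 ^ d * max ‖x c - x b‖ ‖x b - x a‖ ^ d := mul_pow _ _ _
    _ ≤ 2 ^ d * (α / 2 ^ d) := by
        gcongr
        rcases max_choice ‖x c - x b‖ ‖x b - x a‖ with h | h <;> rwa [h]
    _ = α := by field_simp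

theorem update_mem_closePath [DecidableEq ι] (ha : a ≠ l) (hb : b ≠ l) (hc : c ≠ l)
    (x : ι → UnitAddTorus (Fin d)) (y : UnitAddTorus (Fin d)) :
    Function.update x l y ∈ closePath α β a b c ↔ x ∈ closePath α β a b c :=
  and_congr (update_mem_near hb ha α x y) (update_mem_near hc hb β x y)

variable [Fintype ι]

theorem measureReal_near (hd : d ≠ 0) {i j : ι} (hij : i ≠ j) {s : ℝ} (hs : s ∈ Set.Icc 0 1) :
    volume.real (near (d := d) i j s) = s := by
  classical
  simpa using measureReal_inter_near hd hij hs .univ (by simp)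

theorem measureReal_closePath (hd : d ≠ 0) (hα : α ∈ Set.Icc 0 1) (hβ : β ∈ Set.Icc 0 1)
    (hab : a ≠ b) (hac : a ≠ c) (hbc : b ≠ c) :
    volume.real (closePath (d := d) α β a b c) = α * β := by
  classical
  rw [closePath, measureReal_inter_near hd hbc.symm hβ (measurableSet_near b a α)
    (update_mem_near hbc hac α), measureReal_near hd hab.symm hα]

theorem measureReal_closePath_inter_near (hd : d ≠ 0) (hα : α ∈ Set.Icc 0 1)
    (hβ : β ∈ Set.Icc 0 1) {s : ℝ} (hs : s ∈ Set.Icc 0 1) (hab : a ≠ b) (hac : a ≠ c) (hbc : b ≠ c)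
    {e f : ι} (hae : a ≠ e) (hbe : b ≠ e) (hce : c ≠ e) (hef : e ≠ f) :
    volume.real (closePath (d := d) α β a b c ∩ near e f s) = α * β * s := by
  classical
  rw [measureReal_inter_near hd hef hs measurableSet_closePath (update_mem_closePath hae hbe hce),
    measureReal_closePath hd hα hβ hab hac hbc]

theorem measureReal_closePath_inter_closePath (hd : d ≠ 0) (hα : α ∈ Set.Icc 0 1)
    (hβ : β ∈ Set.Icc 0 1) {b' c' : ι} (h : [a, b, c, b', c'].Nodup) :
    volume.real (closePath (d := d) α β a b c ∩ closePath α β a b' c') = α * β * (α * β) := by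
  classical
  obtain ⟨⟨hab, hac, hab', hac'⟩, ⟨hbc, hbb', hbc'⟩, ⟨hcb', hcc'⟩, hb'c'⟩ :
      (a ≠ b ∧ a ≠ c ∧ a ≠ b' ∧ a ≠ c') ∧ (b ≠ c ∧ b ≠ b' ∧ b ≠ c') ∧ (c ≠ b' ∧ c ≠ c') ∧
        b' ≠ c' := by simpa using h
  rw [closePath.eq_def (a := a) (b := b'), ← Set.inter_assoc,
    measureReal_inter_near hd hb'c'.symm hβ
      (measurableSet_closePath.inter (measurableSet_near b' a α)) fun x y => and_congr
        (update_mem_closePath hac' hbc' hcc' x y) (update_mem_near hb'c' hac' α x y),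
    measureReal_closePath_inter_near hd hα hβ hα hab hac hbc hab' hbb' hcb' hab'.symm, mul_assoc]

end ClosePath

section AllBelow

variable {ι : Type*}

/-- The event that all the uniform variables indexed by `S` are below `q`. -/
def allBelow (S : Finset ι) (q : ℝ) : Set (ι → unitInterval) := {u | ∀ e ∈ S, (u e : ℝ) < q}

theorem measurableSet_allBelow (S : Finset ι) (q : ℝ) : MeasurableSet (allBelow S q) := by
  simp only [allBelow, Set.ofPred_forall]
  exact S.measurableSet_biInter fun e _ =>
    measurableSet_lt (measurable_subtype_coe.comp (measurable_pi_apply e)) measurable_const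

theorem allBelow_inter [DecidableEq ι] (S T : Finset ι) (q : ℝ) :
    allBelow S q ∩ allBelow T q = allBelow (S ∪ T) q := by
  ext u
  simp [allBelow, or_imp, forall_and]

theorem measureReal_allBelow [Fintype ι] (S : Finset ι) {q : ℝ} (hq : q ∈ Set.Icc 0 1) :
    volume.real (allBelow S q) = q ^ S.card := by
  rw [measureReal_def, allBelow, volume_forall_lt S (fun _ _ => hq.1) fun _ _ => hq.2,
    Finset.prod_const, ENNReal.toReal_pow, ENNReal.toReal_ofReal hq.1]

end AllBelow

section CloseTriangle

variable {d n : ℕ} {a b c b' c' : Fin n} {α β q : ℝ}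

theorem card_sides (hab : a ≠ b) (hac : a ≠ c) (hbc : b ≠ c) : (sides a b c).card = 3 := by
  refine Finset.card_eq_three.2 ⟨_, _, _, ?_, ?_, ?_, rfl⟩ <;>
    simp [hab, hac, hbc, hab.symm, hac.symm]

theorem disjoint_sides (h : [a, b, c, b', c'].Nodup) :
    Disjoint (sides a b c) (sides a b' c') := by
  rw [Finset.disjoint_left]
  intro e he he'
  simp only [sides, Finset.mem_insert, Finset.mem_singleton] at he he'
  rcases he with rfl | rfl | rfl <;> simp_all [eq_comm]

/-- The event that `a`, `b`, `c` form a close path and the uniform variables of the sides of the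
triangle `a b c` are below `q`. -/
def closeTriangle (α β q : ℝ) (a b c : Fin n) : Set (Sample d n) :=
  closePath α β a b c ×ˢ allBelow (sides a b c) q

theorem measurableSet_closeTriangle : MeasurableSet (closeTriangle (d := d) α β q a b c) :=
  measurableSet_closePath.prod (measurableSet_allBelow _ q)

theorem measureReal_closeTriangle (hd : d ≠ 0) (hα : α ∈ Set.Icc 0 1) (hβ : β ∈ Set.Icc 0 1)
    (hq : q ∈ Set.Icc 0 1) (hab : a ≠ b) (hac : a ≠ c) (hbc : b ≠ c) :
    volume.real (closeTriangle (d := d) α β q a b c) = α * β * q ^ 3 := by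
  rw [closeTriangle, Measure.volume_eq_prod, measureReal_prod_prod,
    measureReal_closePath hd hα hβ hab hac hbc, measureReal_allBelow _ hq, card_sides hab hac hbc]

theorem measureReal_closeTriangle_inter (hd : d ≠ 0) (hα : α ∈ Set.Icc 0 1)
    (hβ : β ∈ Set.Icc 0 1) (hq : q ∈ Set.Icc 0 1) (h : [a, b, c, b', c'].Nodup) :
    volume.real (closeTriangle (d := d) α β q a b c ∩ closeTriangle α β q a b' c') =
      (α * β * q ^ 3) ^ 2 := by
  obtain ⟨⟨hab, hac, hab', hac'⟩, ⟨hbc, -, -⟩, -, hb'c'⟩ :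
      (a ≠ b ∧ a ≠ c ∧ a ≠ b' ∧ a ≠ c') ∧ (b ≠ c ∧ b ≠ b' ∧ b ≠ c') ∧ (c ≠ b' ∧ c ≠ c') ∧
        b' ≠ c' := by simpa using h
  rw [closeTriangle, closeTriangle, Set.prod_inter_prod, allBelow_inter, Measure.volume_eq_prod,
    measureReal_prod_prod, measureReal_closePath_inter_closePath hd hα hβ h,
    measureReal_allBelow _ hq, Finset.card_union_of_disjoint (disjoint_sides h),
    card_sides hab hac hbc, card_sides hab' hac' hb'c']
  ring

theorem measureReal_closeTriangle_inter_le {S : Set (Fin n → UnitAddTorus (Fin d))}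
    (hS : closePath α β a b c ∩ closePath α β a b' c' ⊆ S) :
    volume.real (closeTriangle (d := d) α β q a b c ∩ closeTriangle α β q a b' c') ≤
      volume.real S := by
  refine (measureReal_mono (s₂ := S ×ˢ Set.univ) fun ω hω =>
    ⟨hS ⟨hω.1.1, hω.2.1⟩, trivial⟩).trans_eq ?_
  rw [Measure.volume_eq_prod, measureReal_prod_prod, probReal_univ, mul_one]

/-- Two close triangles at `a` sharing no other vertex are independent; if they share one, their
intersection still forces three pairs of vertices to be close. -/
theorem covariance_closeTriangle_le (hd : d ≠ 0) (hα : α ∈ Set.Icc 0 1) (hβ : β ∈ Set.Icc 0 1)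
    (hq : q ∈ Set.Icc 0 1) (hab : a ≠ b) (hac : a ≠ c) (hbc : b ≠ c) (hab' : a ≠ b')
    (hac' : a ≠ c') (hb'c' : b' ≠ c') (hbc' : b ≠ c') (hcb' : c ≠ b') :
    volume.real (closeTriangle (d := d) α β q a b c ∩ closeTriangle α β q a b' c') -
        volume.real (closeTriangle (d := d) α β q a b c) *
          volume.real (closeTriangle (d := d) α β q a b' c') ≤
      (if b = b' then α * β ^ 2 else 0) + (if c = c' then α * β ^ 2 else 0) +
        (if b = b' ∧ c = c' then α * β else 0) := by
  have hαβ : 0 ≤ α * β ^ 2 := mul_nonneg hα.1 (sq_nonneg β)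
  have hprod : 0 ≤ volume.real (closeTriangle (d := d) α β q a b c) *
    volume.real (closeTriangle (d := d) α β q a b' c') := by positivity
  have hthree {e f : Fin n} (hae : a ≠ e) (hbe : b ≠ e) (hce : c ≠ e) (hef : e ≠ f) :
      volume.real (closePath (d := d) α β a b c ∩ near e f β) = α * β ^ 2 := by
    rw [measureReal_closePath_inter_near hd hα hβ hβ hab hac hbc hae hbe hce hef, sq, mul_assoc]
  rcases eq_or_ne b b' with rfl | hbb' <;> rcases eq_or_ne c c' with rfl | hcc'
  · have := measureReal_closeTriangle_inter_le (q := q) (Set.inter_subset_left :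
      closePath (d := d) α β a b c ∩ closePath α β a b c ⊆ closePath α β a b c)
    rw [measureReal_closePath hd hα hβ hab hac hbc] at this
    simp only [and_self, if_true]
    linarith
  · have := measureReal_closeTriangle_inter_le (q := q) (Set.inter_subset_inter_right _
      Set.inter_subset_right :
      closePath (d := d) α β a b c ∩ closePath α β a b c' ⊆ closePath α β a b c ∩ near c' b β)
    rw [hthree hac' hbc' hcc' hbc'.symm] at this
    simp only [hcc', and_false, if_true, if_false]
    linarith
  · have := measureReal_closeTriangle_inter_le (q := q) (Set.inter_subset_inter_right _
      (Set.inter_subset_right.trans_eq (near_comm c b' β)) :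
      closePath (d := d) α β a b c ∩ closePath α β a b' c ⊆ closePath α β a b c ∩ near b' c β)
    rw [hthree hab' hbb' hcb' hb'c'] at this
    simp only [hbb', false_and, if_true, if_false]
    linarith
  · rw [measureReal_closeTriangle_inter hd hα hβ hq (by simp_all),
      measureReal_closeTriangle hd hα hβ hq hab hac hbc,
      measureReal_closeTriangle hd hα hβ hq hab' hac' hb'c']
    simp only [hbb', hcc', and_false, if_false]
    linarith

end CloseTriangle

section CloseCount

open ProbabilityTheory

variable {d n : ℕ} {a : Fin n} {B₁ B₂ : Finset (Fin n)} {α β q : ℝ}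

/-- The number of pairs `(b, c)` in `B₁ × B₂` that form a close triangle with `a`. -/
noncomputable def closeCount (α β q : ℝ) (a : Fin n) (B₁ B₂ : Finset (Fin n)) (ω : Sample d n) :
    ℝ :=
  ∑ p ∈ B₁ ×ˢ B₂, (closeTriangle α β q a p.1 p.2).indicator 1 ω

theorem memLp_closeCount : MemLp (closeCount (d := d) α β q a B₁ B₂) 2 :=
  memLp_finsetSum _ fun _ _ =>
    memLp_indicator_const 2 measurableSet_closeTriangle (1 : ℝ) (.inr (measure_ne_top _ _))

variable (hd : d ≠ 0) (hα : α ∈ Set.Icc 0 1) (hβ : β ∈ Set.Icc 0 1) (hq : q ∈ Set.Icc 0 1)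
  (ha₁ : a ∉ B₁) (ha₂ : a ∉ B₂) (hB : Disjoint B₁ B₂)
include hd hα hβ hq ha₁ ha₂ hB

theorem integral_closeCount :
    ∫ ω : Sample d n, closeCount α β q a B₁ B₂ ω = B₁.card * B₂.card * (α * β * q ^ 3) := by
  have hvol (p : Fin n × Fin n) (hp : p ∈ B₁ ×ˢ B₂) :
      ∫ ω : Sample d n, (closeTriangle α β q a p.1 p.2).indicator (1 : Sample d n → ℝ) ω =
        α * β * q ^ 3 := by
    obtain ⟨h1, h2⟩ := Finset.mem_product.1 hp
    rw [integral_indicator_one measurableSet_closeTriangle,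
      measureReal_closeTriangle hd hα hβ hq (ne_of_mem_of_not_mem h1 ha₁).symm
        (ne_of_mem_of_not_mem h2 ha₂).symm (hB.forall_ne_finset h1 h2)]
  simp only [closeCount]
  rw [integral_finsetSum _ fun p _ => (integrable_const 1).indicator measurableSet_closeTriangle,
    Finset.sum_congr rfl hvol]
  simp

theorem variance_closeCount_le :
    Var[closeCount (d := d) α β q a B₁ B₂] ≤
      B₁.card * B₂.card * ((B₁.card + B₂.card) * (α * β ^ 2) + α * β) := by
  have hcov (p : Fin n × Fin n) (hp : p ∈ B₁ ×ˢ B₂) (p' : Fin n × Fin n) (hp' : p' ∈ B₁ ×ˢ B₂) :=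
    have h := Finset.mem_product.1 hp
    have h' := Finset.mem_product.1 hp'
    covariance_closeTriangle_le hd hα hβ hq (ne_of_mem_of_not_mem h.1 ha₁).symm
      (ne_of_mem_of_not_mem h.2 ha₂).symm (hB.forall_ne_finset h.1 h.2)
      (ne_of_mem_of_not_mem h'.1 ha₁).symm (ne_of_mem_of_not_mem h'.2 ha₂).symm
      (hB.forall_ne_finset h'.1 h'.2) (hB.forall_ne_finset h.1 h'.2)
      (hB.forall_ne_finset h'.1 h.2).symm
  have hrow (p : Fin n × Fin n) (hp : p ∈ B₁ ×ˢ B₂) :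
      ∑ p' ∈ B₁ ×ˢ B₂, ((if p.1 = p'.1 then α * β ^ 2 else 0) +
        (if p.2 = p'.2 then α * β ^ 2 else 0) + (if p.1 = p'.1 ∧ p.2 = p'.2 then α * β else 0)) =
      (B₁.card + B₂.card) * (α * β ^ 2) + α * β := by
    obtain ⟨h1, h2⟩ := Finset.mem_product.1 hp
    simp only [Finset.sum_add_distrib, ← Prod.ext_iff, Finset.sum_ite_eq, if_pos hp]
    rw [Finset.sum_product_right, Finset.sum_product]
    simp only [Finset.sum_ite_eq, if_pos h1, if_pos h2, Finset.sum_const, nsmul_eq_mul]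
    ring
  unfold closeCount
  rw [variance_sum_indicator _ fun _ => measurableSet_closeTriangle]
  refine (Finset.sum_le_sum fun p hp =>
    (Finset.sum_le_sum fun p' hp' => hcov p hp p' hp').trans_eq (hrow p hp)).trans_eq ?_
  simp [mul_add]

end CloseCount

section Detection

variable {d n k : ℕ} {γ : ℝ≥0∞} {τ w₀ R : ℝ} {w : Fin n → ℝ} {a b c : Fin n} {N : ℕ}
  {B₁ B₂ : Finset (Fin n)}

theorem randomGraph_adj_of_norm_sub_pow_le {ω : Sample d n} (hab : a ≠ b) (ha : a ∈ community n k)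
    (hb : b ∈ community n k) (hnear : ‖ω.1 a - ω.1 b‖ ^ d ≤ w a * w b / (meanWeight τ w₀ * k))
    (hu : ω.2 s(a, b) < retention d γ) : (randomGraph d τ w₀ γ k w ω).Adj a b := by
  refine ⟨hab, ?_⟩
  rwa [edgeProb, if_pos ⟨ha, hb⟩, geomProfile_of_le γ hnear, mul_one]

/-- The smallest scale `w_i w_j / (μ k)` of the connection profile between a community vertex of
weight `u` and the community vertices of weight at least `w₀`. -/
noncomputable def connScale (τ w₀ : ℝ) (k : ℕ) (u : ℝ) : ℝ := u * w₀ / (meanWeight τ w₀ * k)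

theorem connScale_le (hμ : 0 < meanWeight τ w₀) (hw₀ : 0 ≤ w₀) {u v v' : ℝ} (hv : 0 ≤ v)
    (hu : u ≤ v) (hv' : w₀ ≤ v') : connScale τ w₀ k u ≤ v * v' / (meanWeight τ w₀ * k) := by
  unfold connScale
  gcongr

theorem closeTriangle_subset_triangleEvent (hμ : 0 < meanWeight τ w₀) (hw₀ : 0 ≤ w₀)
    (ha : a ∈ community n k) (hb : b ∈ community n k) (hc : c ∈ community n k)
    (hwa : w₀ ≤ w a) (hwb : w₀ ≤ w b) (hwc : w₀ ≤ w c) (hab : a ≠ b) (hac : a ≠ c) (hbc : b ≠ c) :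
    closeTriangle (connScale τ w₀ k (w a)) (connScale τ w₀ k w₀) (retention d γ) a b c ⊆
      triangleEvent d τ w₀ γ k w a b c := by
  rintro ω ⟨hpath, hu⟩
  have hβα : connScale τ w₀ k w₀ ≤ connScale τ w₀ k (w a) := by unfold connScale; gcongr
  have hβ : 0 ≤ connScale τ w₀ k w₀ := by unfold connScale; positivity
  refine ⟨randomGraph_adj_of_norm_sub_pow_le hab ha hb ?_ (hu _ (by simp [sides])),
    randomGraph_adj_of_norm_sub_pow_le hbc hb hc ?_ (hu _ (by simp [sides])),
    randomGraph_adj_of_norm_sub_pow_le hac.symm hc ha ?_ (hu _ (by simp [sides]))⟩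
  · rw [norm_sub_rev]
    exact (norm_sub_pow_le_of_mem_near (hβ.trans hβα) hpath.1).trans
      (connScale_le hμ hw₀ (hw₀.trans hwa) le_rfl hwb)
  · rw [norm_sub_rev]
    exact (norm_sub_pow_le_of_mem_near hβ hpath.2).trans
      (connScale_le hμ hw₀ (hw₀.trans hwb) hwb hwc)
  · rw [mul_comm (w c)]
    exact (norm_sub_pow_le_of_mem_closePath hβα hpath).trans
      (connScale_le hμ hw₀ (hw₀.trans hwa) le_rfl hwc)

/-- Two disjoint sets of `N` vertices of `U` other than `a`, with weights between `w₀` and `R`: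
the second moment method is applied to the close triangles of `a` with one vertex in each. -/
structure IsLightPair (w : Fin n → ℝ) (U : Finset (Fin n)) (w₀ R : ℝ) (a : Fin n) (N : ℕ)
    (B₁ B₂ : Finset (Fin n)) : Prop where
  disjoint : Disjoint B₁ B₂
  card_left : B₁.card = N
  card_right : B₂.card = N
  light : ∀ b ∈ B₁ ∪ B₂, b ∈ U ∧ a ≠ b ∧ w b ∈ Set.Icc w₀ R

theorem mul_closeCount_le_localTriangles (hμ : 0 < meanWeight τ w₀) (hw₀ : 0 ≤ w₀)
    (hw : ∀ i, 0 < w i) (ha : a ∈ community n k) (hwa : w₀ ≤ w a)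
    (hB : IsLightPair w (community n k) w₀ R a N B₁ B₂) (ω : Sample d n) :
    n / (w a ^ 2 * R ^ 2) *
      closeCount (connScale τ w₀ k (w a)) (connScale τ w₀ k w₀) (retention d γ) a B₁ B₂ ω ≤
    localTriangles w (randomGraph d τ w₀ γ k w ω) a := by
  have hterm (p : Fin n × Fin n) (hp : p ∈ B₁ ×ˢ B₂) :
      1 / R ^ 2 * (closeTriangle (connScale τ w₀ k (w a)) (connScale τ w₀ k w₀)
        (retention d γ) a p.1 p.2).indicator 1 ω ≤
      (triangleEvent d τ w₀ γ k w a p.1 p.2).indicator (fun _ => 1 / (w p.1 * w p.2)) ω := by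
    obtain ⟨h1, h2⟩ := Finset.mem_product.1 hp
    obtain ⟨hbC, hab, hwb⟩ := hB.light p.1 (Finset.mem_union_left _ h1)
    obtain ⟨hcC, hac, hwc⟩ := hB.light p.2 (Finset.mem_union_right _ h2)
    have hb := hw p.1
    have hc := hw p.2
    have hR : 0 ≤ R := hb.le.trans hwb.2
    by_cases hω : ω ∈ closeTriangle (connScale τ w₀ k (w a)) (connScale τ w₀ k w₀)
        (retention d γ) a p.1 p.2
    · rw [Set.indicator_of_mem hω, Set.indicator_of_mem (closeTriangle_subset_triangleEvent hμ hw₀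
        ha hbC hcC hwa hwb.1 hwc.1 hab hac (hB.disjoint.forall_ne_finset h1 h2) hω),
        Pi.one_apply, mul_one, sq]
      exact one_div_le_one_div_of_le (mul_pos hb hc) (mul_le_mul hwb.2 hwc.2 hc.le hR)
    · rw [Set.indicator_of_notMem hω, mul_zero]
      exact Set.indicator_nonneg (fun _ _ => by positivity) ω
  rw [localTriangles_eq_sum_indicator, ← Fintype.sum_prod_type', ← div_div, div_eq_mul_one_div,
    mul_assoc, closeCount, Finset.mul_sum]
  refine mul_le_mul_of_nonneg_left ((Finset.sum_le_sum hterm).trans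
    (Finset.sum_le_univ_sum_of_nonneg fun p => Set.indicator_nonneg (fun _ _ => ?_) ω))
    (by positivity)
  have hb := hw p.1
  have hc := hw p.2
  positivity

theorem closeCount_le_of_notMem_detected (hμ : 0 < meanWeight τ w₀) (hw₀ : 0 ≤ w₀)
    (hw : ∀ i, 0 < w i) (hn : 0 < n) (ha : a ∈ community n k) (hwa : w₀ ≤ w a) (hR : 0 < R)
    (hB : IsLightPair w (community n k) w₀ R a N B₁ B₂) {ω : Sample d n}
    (hω : ω ∉ detected d τ w₀ γ k w a) :
    closeCount (connScale τ w₀ k (w a)) (connScale τ w₀ k w₀) (retention d γ) a B₁ B₂ ω ≤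
      R ^ 2 * w a / √(Real.log n) := by
  have := hw a
  have hn' : (0 : ℝ) < n := by positivity
  have hW := (mul_closeCount_le_localTriangles hμ hw₀ hw ha hwa hB ω).trans
    (not_lt.1 fun h => hω (mem_detected.2 h))
  rw [div_mul_eq_mul_div, div_le_iff₀ (by positivity)] at hW
  refine le_of_mul_le_mul_left (hW.trans_eq ?_) hn'
  field

theorem measureReal_compl_detected_le_of_le_mean (hd : d ≠ 0) (hμ : 0 < meanWeight τ w₀)
    (hw₀ : 0 < w₀) (hw : ∀ i, 0 < w i) (hn : 1 < n) (ha : a ∈ community n k) (hwa : w₀ ≤ w a)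
    (hB : IsLightPair w (community n k) w₀ R a N B₁ B₂) (hN : 0 < N) {α β : ℝ}
    (hα : α = connScale τ w₀ k (w a)) (hβ : β = connScale τ w₀ k w₀) (hα₁ : α ≤ 1)
    (hthr : R ^ 2 * w a / √(Real.log n) ≤ N ^ 2 * (α * β * retention d γ ^ 3) / 2) :
    volume.real (detected d τ w₀ γ k w a)ᶜ ≤
      8 / (N * α * retention d γ ^ 6) + 4 / (N ^ 2 * (α * β) * retention d γ ^ 6) := by
  have hk : (0 : ℝ) < k := by exact_mod_cast (mem_community.1 ha).pos
  have hwa' := hw a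
  have hα₀ : 0 < α := by rw [hα, connScale]; positivity
  have hβ₀ : 0 < β := by rw [hβ, connScale]; positivity
  have hβα : β ≤ α := by rw [hα, hβ, connScale, connScale]; gcongr
  have hq₀ := retention_pos d γ
  have hα' : α ∈ Set.Icc 0 1 := ⟨hα₀.le, hα₁⟩
  have hβ' : β ∈ Set.Icc 0 1 := ⟨hβ₀.le, hβα.trans hα₁⟩
  have hq' : retention d γ ∈ Set.Icc 0 1 := ⟨hq₀.le, retention_le_one d γ⟩
  have ha₁ : a ∉ B₁ := fun h => (hB.light a (Finset.mem_union_left _ h)).2.1 rfl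
  have ha₂ : a ∉ B₂ := fun h => (hB.light a (Finset.mem_union_right _ h)).2.1 rfl
  have hmean := integral_closeCount hd hα' hβ' hq' ha₁ ha₂ hB.disjoint
  have hvar := variance_closeCount_le hd hα' hβ' hq' ha₁ ha₂ hB.disjoint
  rw [hB.card_left, hB.card_right] at hmean hvar
  obtain ⟨b, hb⟩ := Finset.card_pos.1 (hN.trans_eq hB.card_left.symm)
  have hR : 0 < R := (hw b).trans_le (hB.light b (Finset.mem_union_left _ hb)).2.2.2
  have hsub : (detected d τ w₀ γ k w a)ᶜ ⊆ {ω | closeCount α β (retention d γ) a B₁ B₂ ω ≤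
      (∫ ω : Sample d n, closeCount α β (retention d γ) a B₁ B₂ ω) / 2} := by
    intro ω hω
    rw [Set.mem_ofPred_eq, hmean, ← sq, hα, hβ]
    exact (closeCount_le_of_notMem_detected hμ hw₀.le hw (by lia) ha hwa hR hB hω).trans
      (hα ▸ hβ ▸ hthr)
  calc volume.real (detected d τ w₀ γ k w a)ᶜ
      ≤ _ := measureReal_mono hsub
    _ ≤ _ := measureReal_le_half_integral_le memLp_closeCount (by rw [hmean]; positivity)
    _ ≤ 4 * (N * N * ((N + N) * (α * β ^ 2) + α * β)) /
          (N * N * (α * β * retention d γ ^ 3)) ^ 2 := by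
        rw [hmean]
        gcongr
    _ = _ := by field

theorem measureReal_compl_detected_le (hd : d ≠ 0) (hμ : 0 < meanWeight τ w₀)
    (hw₀ : 0 < w₀) (hw : ∀ i, 0 < w i) (hn : 1 < n) (ha : a ∈ community n k) (hwa : w₀ ≤ w a)
    (hB : IsLightPair w (community n k) w₀ R a N B₁ B₂) {c : ℝ} (hc : 0 < c) (hcN : c * k ≤ N)
    (hα : connScale τ w₀ k (w a) ≤ 1)
    (hthr : R ^ 2 / √(Real.log n) ≤
      c ^ 2 * w₀ ^ 3 * retention d γ ^ 3 / (2 * meanWeight τ w₀ ^ 2)) :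
    volume.real (detected d τ w₀ γ k w a)ᶜ ≤
      (8 * meanWeight τ w₀ / (c * w₀) + 4 * meanWeight τ w₀ ^ 2 / (c ^ 2 * w₀ ^ 3)) /
        retention d γ ^ 6 / w a := by
  have hk : (0 : ℝ) < k := by exact_mod_cast (mem_community.1 ha).pos
  have hwa' := hw a
  have hq₀ := retention_pos d γ
  have hN : 0 < N := by exact_mod_cast (mul_pos hc hk).trans_le hcN
  have hα_low : c * w₀ * w a / meanWeight τ w₀ ≤ N * connScale τ w₀ k (w a) :=
    calc c * w₀ * w a / meanWeight τ w₀ = c * k * connScale τ w₀ k (w a) := by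
          unfold connScale; field
      _ ≤ _ := mul_le_mul_of_nonneg_right hcN (by unfold connScale; positivity)
  have hαβ_low : c ^ 2 * w₀ ^ 3 * w a / meanWeight τ w₀ ^ 2 ≤
      N ^ 2 * (connScale τ w₀ k (w a) * connScale τ w₀ k w₀) :=
    calc c ^ 2 * w₀ ^ 3 * w a / meanWeight τ w₀ ^ 2 =
          (c * k) ^ 2 * (connScale τ w₀ k (w a) * connScale τ w₀ k w₀) := by
          unfold connScale; field
      _ ≤ _ := by gcongr; unfold connScale; positivity
  refine (measureReal_compl_detected_le_of_le_mean hd hμ hw₀ hw hn ha hwa hB hN rfl rfl hα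
    ?_).trans ?_
  · calc R ^ 2 * w a / √(Real.log n) = R ^ 2 / √(Real.log n) * w a := by ring
      _ ≤ c ^ 2 * w₀ ^ 3 * retention d γ ^ 3 / (2 * meanWeight τ w₀ ^ 2) * w a := by gcongr
      _ = c ^ 2 * w₀ ^ 3 * w a / meanWeight τ w₀ ^ 2 * retention d γ ^ 3 / 2 := by ring
      _ ≤ _ := by rw [← mul_assoc ((N : ℝ) ^ 2)]; gcongr
  · calc _ ≤ 8 / (c * w₀ * w a / meanWeight τ w₀ * retention d γ ^ 6) +
          4 / (c ^ 2 * w₀ ^ 3 * w a / meanWeight τ w₀ ^ 2 * retention d γ ^ 6) := by gcongr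
      _ = _ := by field

end Detection

/-! ### Power-law weights -/

section Moments

theorem lintegral_Ioc_zero_rpow {c s : ℝ} (hc : 0 ≤ c) (hs : 0 < s) :
    ∫⁻ x in Set.Ioc 0 c, ENNReal.ofReal (x ^ (s - 1)) = ENNReal.ofReal (c ^ s / s) := by
  rw [← ofReal_integral_eq_lintegral_ofReal, ← intervalIntegral.integral_of_le hc,
    integral_rpow (.inl (by linarith)), sub_add_cancel, Real.zero_rpow hs.ne', sub_zero]
  · exact (intervalIntegrable_iff_integrableOn_Ioc_of_le hc).1
      (intervalIntegral.intervalIntegrable_rpow' (by linarith))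
  · exact ae_restrict_of_forall_mem measurableSet_Ioc fun x hx => Real.rpow_nonneg hx.1.le _

theorem lintegral_Ioi_rpow {c r : ℝ} (hc : 0 < c) (hr : 0 < r) :
    ∫⁻ x in Set.Ioi c, ENNReal.ofReal (x ^ (-r - 1)) = ENNReal.ofReal (c ^ (-r) / r) := by
  rw [← ofReal_integral_eq_lintegral_ofReal (integrableOn_Ioi_rpow_of_lt (by linarith) hc)
    (ae_restrict_of_forall_mem measurableSet_Ioi fun x hx => Real.rpow_nonneg (hc.trans hx).le _),
    integral_Ioi_rpow_of_lt (by linarith) hc, sub_add_cancel, neg_div_neg_eq]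

theorem lintegral_rpow_le_of_tail {α : Type*} [MeasurableSpace α] {m : Measure α} {f : α → ℝ}
    (hf : 0 ≤ᵐ[m] f) (hfm : AEMeasurable f m) {x₀ β s : ℝ} {D : ℝ≥0∞} (hx₀ : 0 < x₀) (hs : 0 < s)
    (hsβ : s < β) (htail : ∀ x, x₀ ≤ x → m {a | x < f a} ≤ D * ENNReal.ofReal (x ^ (-β))) :
    ∫⁻ a, ENNReal.ofReal (f a ^ s) ∂m ≤ ENNReal.ofReal s *
      (m Set.univ * ENNReal.ofReal (x₀ ^ s / s) +
        D * ENNReal.ofReal (x₀ ^ (-(β - s)) / (β - s))) := by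
  have hlow : ∫⁻ x in Set.Ioc 0 x₀, m {a | x < f a} * ENNReal.ofReal (x ^ (s - 1)) ≤
      m Set.univ * ENNReal.ofReal (x₀ ^ s / s) := by
    rw [← lintegral_Ioc_zero_rpow hx₀.le hs, ← lintegral_const_mul _ (by fun_prop)]
    gcongr
    exact Set.subset_univ _
  have hhigh : ∫⁻ x in Set.Ioi x₀, m {a | x < f a} * ENNReal.ofReal (x ^ (s - 1)) ≤
      D * ENNReal.ofReal (x₀ ^ (-(β - s)) / (β - s)) := by
    rw [← lintegral_Ioi_rpow hx₀ (sub_pos.2 hsβ), ← lintegral_const_mul _ (by fun_prop)]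
    refine setLIntegral_mono' measurableSet_Ioi fun x hx => ?_
    have hx₀x := hx₀.trans hx
    calc m {a | x < f a} * ENNReal.ofReal (x ^ (s - 1))
        ≤ D * ENNReal.ofReal (x ^ (-β)) * ENNReal.ofReal (x ^ (s - 1)) :=
          mul_le_mul_left (htail x (le_of_lt hx)) _
      _ = D * ENNReal.ofReal (x ^ (-(β - s) - 1)) := by
        rw [mul_assoc, ← ENNReal.ofReal_mul (by positivity), ← Real.rpow_add hx₀x]
        ring_nf
  rw [lintegral_rpow_eq_lintegral_meas_lt_mul m hf hfm hs, ← Set.Ioc_union_Ioi_eq_Ioi hx₀.le]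
  exact mul_le_mul_right ((lintegral_union_le _ _ _).trans (add_le_add hlow hhigh)) _

theorem sum_rpow_le_of_tail {ι : Type*} {S : Finset ι} {w : ι → ℝ} (hw : ∀ i ∈ S, 0 ≤ w i)
    {x₀ β s D : ℝ} (hx₀ : 0 < x₀) (hD : 0 ≤ D) (hs : 0 < s) (hsβ : s < β)
    (htail : ∀ x, x₀ ≤ x → ((S.filter fun i => x < w i).card : ℝ) ≤ D * x ^ (-β)) :
    ∑ i ∈ S, w i ^ s ≤ s * (S.card * (x₀ ^ s / s) + D * (x₀ ^ (-(β - s)) / (β - s))) := by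
  let _ : MeasurableSpace ι := ⊤
  have := sub_pos.2 hsβ
  have hcount (x : ℝ) : Measure.count.restrict (S : Set ι) {i | x < w i} =
      ENNReal.ofReal (S.filter fun i => x < w i).card := by
    rw [Measure.restrict_apply .of_discrete, Set.inter_comm, ENNReal.ofReal_natCast,
      ← Measure.count_apply_finset, Finset.coe_filter]
    rfl
  have h := lintegral_rpow_le_of_tail (m := Measure.count.restrict (S : Set ι)) (f := w)
    (D := ENNReal.ofReal D) (ae_restrict_of_forall_mem .of_discrete hw) (by measurability) hx₀ hs
    hsβ fun x hx => by
      rw [hcount, ← ENNReal.ofReal_mul hD]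
      exact ENNReal.ofReal_le_ofReal (htail x hx)
  rw [Measure.restrict_apply_univ, Measure.count_apply_finset, ← ENNReal.ofReal_natCast,
    ← ENNReal.ofReal_mul (by positivity), ← ENNReal.ofReal_mul hD,
    ← ENNReal.ofReal_add (by positivity) (by positivity), ← ENNReal.ofReal_mul hs.le,
    lintegral_finset] at h
  simp only [Measure.count_singleton, mul_one] at h
  rwa [← ENNReal.ofReal_sum_of_nonneg fun i hi => Real.rpow_nonneg (hw i hi) s,
    ENNReal.ofReal_le_ofReal_iff (by positivity)] at h

end Moments

section Truncation

/-- The level `x ^ (1 / (τ - 1)) / log x` up to which the weights of `x` vertices are assumed to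
follow the power law. -/
noncomputable def truncation (τ x : ℝ) : ℝ := x ^ (1 / (τ - 1)) / Real.log x

variable {τ : ℝ} (hτ : 1 < τ)
include hτ

theorem mul_truncation_rpow {x : ℝ} (hx : 1 < x) :
    x * truncation τ x ^ (1 - τ) = Real.log x ^ (τ - 1) := by
  have hl := Real.log_pos hx
  have hτ₁ : τ - 1 ≠ 0 := (sub_pos.2 hτ).ne'
  rw [truncation, Real.div_rpow (by positivity) hl.le, ← Real.rpow_mul (by positivity),
    ← neg_sub τ 1, mul_neg, one_div_mul_cancel hτ₁, Real.rpow_neg hl.le, Real.rpow_neg_one]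
  field

theorem eventually_log_le_truncation_rpow {δ : ℝ} (hδ : 0 < δ) :
    ∀ᶠ x in atTop, Real.log x ≤ truncation τ x ^ δ := by
  have hτ₁ : 0 < 1 / (τ - 1) * δ := mul_pos (one_div_pos.2 (sub_pos.2 hτ)) hδ
  filter_upwards [(isLittleO_log_rpow_rpow_atTop (1 + δ) hτ₁).bound one_pos,
    eventually_gt_atTop 1] with x hx hx₁
  have hl := Real.log_pos hx₁
  rw [one_mul, Real.norm_of_nonneg (by positivity), Real.norm_of_nonneg (by positivity),
    Real.rpow_add hl, Real.rpow_one, Real.rpow_mul (by positivity)] at hx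
  rwa [truncation, Real.div_rpow (by positivity) hl.le, le_div_iff₀ (by positivity)]

theorem tendsto_truncation : Tendsto (truncation τ) atTop atTop :=
  tendsto_atTop_mono' _
    ((eventually_log_le_truncation_rpow hτ one_pos).mono fun _ h => by rwa [Real.rpow_one] at h)
    Real.tendsto_log_atTop

end Truncation

theorem card_community {n k : ℕ} (hkn : k ≤ n) : (community n k).card = k := by
  rw [community, Fin.card_filter_val_lt, min_eq_right hkn]

theorem card_filter_lt_eq {n : ℕ} {S : Finset (Fin n)} (hS : 0 < S.card) (w : Fin n → ℝ) (x : ℝ) :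
    ((S.filter fun i => x < w i).card : ℝ) = S.card * (1 - empCDF S w x) := by
  have h : ((S.filter fun i => w i ≤ x).card : ℝ) + (S.filter fun i => x < w i).card = S.card := by
    simp_rw [← not_le]
    exact_mod_cast Finset.card_filter_add_card_filter_not (s := S) fun i => w i ≤ x
  rw [empCDF, mul_sub, mul_one, mul_div_cancel₀ _ (by positivity), ← h, add_sub_cancel_left]

/-- Conditions 1–3 on the weights for the sets of vertices `S n`: the weights of `S n` follow the
power law `C x ^ (1 - τ)` uniformly between `w₀` and the truncation level of `S n`, and are at most
`|S n| ^ (1 / (τ - 1) + o(1))`. -/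
structure PowerLawWeights (τ C w₀ : ℝ) (S : (n : ℕ) → Finset (Fin n)) (w : (n : ℕ) → Fin n → ℝ) :
    Prop where
  tail : ∀ ε : ℝ, 0 < ε → ∀ᶠ n in atTop, ∀ x : ℝ, w₀ ≤ x → x ≤ truncation τ (S n).card →
    |1 - empCDF (S n) (w n) x - C * x ^ (1 - τ)| ≤ ε * (C * x ^ (1 - τ))
  le_rpow : ∀ ε : ℝ, 0 < ε → ∀ᶠ n in atTop, ∀ i ∈ S n,
    w n i ≤ ((S n).card : ℝ) ^ (1 / (τ - 1) + ε)

namespace PowerLawWeights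

variable {τ C w₀ : ℝ} {S V : (n : ℕ) → Finset (Fin n)} {w : (n : ℕ) → Fin n → ℝ}

theorem of_card_eq {m : ℕ → ℕ} (hm : ∀ᶠ n in atTop, (S n).card = m n)
    (htail : ∀ ε : ℝ, 0 < ε → ∀ᶠ n in atTop, ∀ x : ℝ, w₀ ≤ x → x ≤ truncation τ (m n) →
      |1 - empCDF (S n) (w n) x - C * x ^ (1 - τ)| ≤ ε * (C * x ^ (1 - τ)))
    (hle : ∀ ε : ℝ, 0 < ε → ∀ᶠ n in atTop, ∀ i ∈ S n, w n i ≤ (m n : ℝ) ^ (1 / (τ - 1) + ε)) :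
    PowerLawWeights τ C w₀ S w where
  tail ε hε := by filter_upwards [hm, htail ε hε] with n hn h; rwa [hn]
  le_rpow ε hε := by filter_upwards [hm, hle ε hε] with n hn h; rwa [hn]

variable (h : PowerLawWeights τ C w₀ S w) (hS : Tendsto (fun n => (S n).card) atTop atTop)
include h hS

theorem eventually_card_filter_lt_mem_Icc {ε : ℝ} (hε : 0 < ε) :
    ∀ᶠ n in atTop, ∀ x, w₀ ≤ x → x ≤ truncation τ (S n).card →
      (((S n).filter fun i => x < w n i).card : ℝ) ∈
        Set.Icc ((S n).card * ((1 - ε) * (C * x ^ (1 - τ))))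
          ((S n).card * ((1 + ε) * (C * x ^ (1 - τ)))) := by
  filter_upwards [h.tail ε hε, hS.eventually_gt_atTop 0] with n hn hpos x hx hxL
  obtain ⟨h₁, h₂⟩ := abs_le.1 (hn x hx hxL)
  rw [card_filter_lt_eq hpos]
  constructor <;> gcongr <;> linarith

theorem eventually_card_filter_lt_le_of_truncation_le (hτ : 1 < τ) (hC : 0 ≤ C) {β : ℝ}
    (hβ₀ : 0 < β) (hβ : β < τ - 1) :
    ∀ᶠ n in atTop, ∀ x, truncation τ (S n).card ≤ x →
      (((S n).filter fun i => x < w n i).card : ℝ) ≤ 2 * C * (S n).card * x ^ (-β) := by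
  have hτ₁ : 0 < τ - 1 := sub_pos.2 hτ
  have hgap : 0 < 1 - β / (τ - 1) := sub_pos.2 ((div_lt_one hτ₁).2 hβ)
  obtain ⟨η, hη₀, hη⟩ := exists_between hgap
  have hε : 0 < (1 - β / (τ - 1) - η) / β := div_pos (sub_pos.2 hη) hβ₀
  have hSR := tendsto_natCast_atTop_atTop (R := ℝ).comp hS
  filter_upwards [h.eventually_card_filter_lt_mem_Icc hS one_pos, h.le_rpow _ hε,
    hSR.eventually ((isLittleO_log_rpow_rpow_atTop (τ - 1) hη₀).bound one_pos),
    hSR.eventually ((tendsto_truncation hτ).eventually_ge_atTop w₀), hSR.eventually_gt_atTop 1,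
    hSR.eventually ((tendsto_truncation hτ).eventually_gt_atTop 0)]
    with n hcard hle hlog hw₀ hm htr x hx
  simp only [Function.comp_apply] at hm hlog hw₀ htr
  have hx₀ : 0 < x := htr.trans_le hx
  have hm₀ : (0 : ℝ) < (S n).card := one_pos.trans hm
  have hl := Real.log_pos hm
  rw [Real.norm_of_nonneg (by positivity), Real.norm_of_nonneg (by positivity), one_mul] at hlog
  obtain hempty | ⟨i, hi⟩ := ((S n).filter fun i => x < w n i).eq_empty_or_nonempty
  · rw [hempty, Finset.card_empty, Nat.cast_zero]
    positivity
  obtain ⟨hiS, hxi⟩ := Finset.mem_filter.1 hi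
  have hexp : η = 1 + (1 / (τ - 1) + (1 - β / (τ - 1) - η) / β) * (-β) := by field
  have hpow : ((S n).card : ℝ) ^ η ≤ (S n).card * x ^ (-β) :=
    calc ((S n).card : ℝ) ^ η
        = (S n).card * (((S n).card : ℝ) ^ (1 / (τ - 1) + (1 - β / (τ - 1) - η) / β)) ^ (-β) := by
          rw [← Real.rpow_mul hm₀.le, ← Real.rpow_one_add' hm₀.le, ← hexp]
          exact hexp ▸ hη₀.ne'
      _ ≤ (S n).card * x ^ (-β) := mul_le_mul_of_nonneg_left
          (Real.rpow_le_rpow_of_nonpos hx₀ (hxi.le.trans (hle i hiS)) (by linarith)) hm₀.le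
  calc (((S n).filter fun i => x < w n i).card : ℝ)
      ≤ ((S n).filter fun i => truncation τ (S n).card < w n i).card := by
        exact_mod_cast Finset.card_le_card (Finset.monotone_filter_right _ fun i _ => hx.trans_lt)
    _ ≤ (S n).card * ((1 + 1) * (C * truncation τ (S n).card ^ (1 - τ))) :=
        (hcard _ hw₀ le_rfl).2
    _ = 2 * C * Real.log (S n).card ^ (τ - 1) := by
        rw [← mul_truncation_rpow hτ hm]
        ring
    _ ≤ 2 * C * (S n).card * x ^ (-β) := by
        rw [mul_assoc (2 * C)]
        exact mul_le_mul_of_nonneg_left (hlog.trans hpow) (by positivity)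

theorem exists_card_filter_lt_le (hτ : 1 < τ) (hC : 0 ≤ C) (hw₀ : 0 < w₀) {β : ℝ} (hβ₀ : 0 < β)
    (hβ : β < τ - 1) :
    ∃ D : ℝ, 0 ≤ D ∧ ∀ᶠ n in atTop, ∀ x, w₀ ≤ x →
      (((S n).filter fun i => x < w n i).card : ℝ) ≤ D * (S n).card * x ^ (-β) := by
  refine ⟨2 * C * max (w₀ ^ (β + 1 - τ)) 1, by positivity, ?_⟩
  filter_upwards [h.eventually_card_filter_lt_mem_Icc hS one_pos,
    h.eventually_card_filter_lt_le_of_truncation_le hS hτ hC hβ₀ hβ] with n hlow hhigh x hx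
  have hx₀ : 0 < x := hw₀.trans_le hx
  obtain hxL | hxL := le_total x (truncation τ (S n).card)
  · calc (((S n).filter fun i => x < w n i).card : ℝ)
        ≤ (S n).card * ((1 + 1) * (C * x ^ (1 - τ))) := (hlow x hx hxL).2
      _ = 2 * C * x ^ (β + 1 - τ) * (S n).card * x ^ (-β) := by
        rw [show 1 - τ = β + 1 - τ + -β by ring, Real.rpow_add hx₀]
        ring
      _ ≤ _ := by
        gcongr
        exact (Real.rpow_le_rpow_of_nonpos hw₀ hx (by linarith)).trans (le_max_left _ _)
  · calc (((S n).filter fun i => x < w n i).card : ℝ)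
        ≤ 2 * C * 1 * (S n).card * x ^ (-β) := by simpa only [mul_one] using hhigh x hxL
      _ ≤ _ := by gcongr; exact le_max_right _ _

theorem exists_sum_rpow_le (hτ : 1 < τ) (hC : 0 ≤ C) (hw₀ : 0 < w₀) (hw : ∀ n i, 0 < w n i) {s : ℝ}
    (hs₀ : 0 < s) (hs : s < τ - 1) :
    ∃ M : ℝ, 0 ≤ M ∧ ∀ᶠ n in atTop, ∑ i ∈ S n, w n i ^ s ≤ M * (S n).card := by
  obtain ⟨β, hsβ, hβ⟩ := exists_between hs
  have := sub_pos.2 hsβ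
  obtain ⟨D, hD, hcard⟩ := h.exists_card_filter_lt_le hS hτ hC hw₀ (hs₀.trans hsβ) hβ
  refine ⟨s * (w₀ ^ s / s + D * (w₀ ^ (-(β - s)) / (β - s))), by positivity, ?_⟩
  filter_upwards [hcard] with n hn
  refine (sum_rpow_le_of_tail (fun i _ => (hw n i).le) hw₀ (by positivity) hs₀ hsβ hn).trans_eq ?_
  ring

theorem exists_card_filter_band_ge (hτ : 1 < τ) (hC : 0 < C) (hw₀ : 0 < w₀) :
    ∃ c : ℝ, 0 < c ∧ ∀ᶠ n in atTop,
      c * (S n).card ≤ ((S n).filter fun i => w n i ∈ Set.Ioc w₀ (2 * w₀)).card := by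
  have hρ : 0 < 1 - (2 : ℝ) ^ (1 - τ) :=
    sub_pos.2 (Real.rpow_lt_one_of_one_lt_of_neg one_lt_two (by linarith))
  refine ⟨C * w₀ ^ (1 - τ) * (1 - 2 ^ (1 - τ)) / 2, by positivity, ?_⟩
  have hL := (tendsto_truncation hτ).comp (tendsto_natCast_atTop_atTop.comp hS)
  filter_upwards [h.eventually_card_filter_lt_mem_Icc hS
    (ε := (1 - 2 ^ (1 - τ)) / 4) (by positivity), hL.eventually_ge_atTop (2 * w₀)] with n hcard hn
  simp only [Function.comp_apply] at hn
  have hlow := (hcard w₀ le_rfl (by linarith)).1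
  have hhigh := (hcard (2 * w₀) (by linarith) hn).2
  rw [Real.mul_rpow zero_le_two hw₀.le] at hhigh
  have hsplit : (((S n).filter fun i => w₀ < w n i).card : ℝ) ≤
      ((S n).filter fun i => w n i ∈ Set.Ioc w₀ (2 * w₀)).card +
        ((S n).filter fun i => 2 * w₀ < w n i).card := by
    refine mod_cast (Finset.card_le_card fun i hi => ?_).trans (Finset.card_union_le _ _)
    simp only [Finset.mem_union, Finset.mem_filter, Set.mem_Ioc] at hi ⊢
    have := le_or_gt (w n i) (2 * w₀)
    tauto
  have hsq : 0 ≤ (S n).card * (C * w₀ ^ (1 - τ)) * (1 - (2 : ℝ) ^ (1 - τ)) ^ 2 / 4 := by positivity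
  linarith

theorem exists_isLightPair (hτ : 1 < τ) (hC : 0 < C) (hw₀ : 0 < w₀) :
    ∃ c : ℝ, 0 < c ∧ ∀ᶠ n in atTop, ∀ a, 2 * w₀ < w n a → ∃ (N : ℕ) (B₁ B₂ : Finset (Fin n)),
      c * (S n).card ≤ N ∧ IsLightPair (w n) (S n) w₀ (2 * w₀) a N B₁ B₂ := by
  obtain ⟨c, hc, hband⟩ := h.exists_card_filter_band_ge hS hτ hC hw₀
  have hSR := (tendsto_natCast_atTop_atTop (R := ℝ).comp hS).const_mul_atTop hc
  refine ⟨c / 4, by positivity, ?_⟩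
  filter_upwards [hband, hSR.eventually_ge_atTop 2] with n hn hlarge a ha
  set B := (S n).filter fun i => w n i ∈ Set.Ioc w₀ (2 * w₀)
  have hlarge' : 2 ≤ B.card := by exact_mod_cast hlarge.trans hn
  obtain ⟨B₁, hB₁, hc₁⟩ := Finset.exists_subset_card_eq (s := B) (n := B.card / 2) (by lia)
  obtain ⟨B₂, hB₂, hc₂⟩ := Finset.exists_subset_card_eq (s := B \ B₁) (n := B.card / 2) (by
    rw [Finset.card_sdiff_of_subset hB₁]; lia)
  refine ⟨B.card / 2, B₁, B₂, ?_,
    ⟨Finset.disjoint_of_subset_right hB₂ Finset.disjoint_sdiff, hc₁, hc₂, fun b hb => ?_⟩⟩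
  · have hhalf : (B.card : ℝ) ≤ 4 * (B.card / 2 : ℕ) := by
      exact_mod_cast (by lia : B.card ≤ 4 * (B.card / 2))
    linarith
  · have hbB := Finset.union_subset hB₁ (hB₂.trans Finset.sdiff_subset) hb
    obtain ⟨hbS, hlow, hhigh⟩ := Finset.mem_filter.1 hbB
    exact ⟨hbS, fun hab => (hab ▸ ha).not_ge hhigh, hlow.le, hhigh⟩

theorem eventually_mul_log_le_card_heavy (hτ : 2 ≤ τ) (hC : 0 < C) (hw₀ : 0 < w₀) :
    ∀ᶠ n in atTop, ∀ t, w₀ ≤ t → t ≤ truncation τ (S n).card →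
      C / 2 * Real.log (S n).card ≤ (heavy (w n) (S n) t).card := by
  have hSR := tendsto_natCast_atTop_atTop (R := ℝ).comp hS
  filter_upwards [h.eventually_card_filter_lt_mem_Icc hS one_half_pos, hSR.eventually_gt_atTop 1,
    (Real.tendsto_log_atTop.comp hSR).eventually_ge_atTop 1] with n hcard hm hlog t ht htL
  simp only [Function.comp_apply] at hm hlog
  calc C / 2 * Real.log (S n).card
      ≤ C / 2 * Real.log (S n).card ^ (τ - 1) := by
        gcongr
        exact Real.self_le_rpow_of_one_le hlog (by linarith)
    _ = C / 2 * ((S n).card * truncation τ (S n).card ^ (1 - τ)) := by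
        rw [mul_truncation_rpow (by linarith) hm]
    _ ≤ C / 2 * ((S n).card * t ^ (1 - τ)) := by
        gcongr ?_ * (?_ * ?_)
        exact Real.rpow_le_rpow_of_nonpos (hw₀.trans_le ht) htL (by linarith)
    _ = (S n).card * ((1 - 1 / 2) * (C * t ^ (1 - τ))) := by ring
    _ ≤ ((S n).filter fun i => t < w n i).card := (hcard t ht htL).1
    _ ≤ (heavy (w n) (S n) t).card := by
        exact_mod_cast Finset.card_le_card (Finset.monotone_filter_right _ fun i _ => le_of_lt)

theorem eventually_le_mul_card (hτ : 2 < τ) {η : ℝ} (hη : 0 < η) :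
    ∀ᶠ n in atTop, ∀ i ∈ S n, w n i ≤ η * (S n).card := by
  have hτ₁ : 1 / (τ - 1) < 1 := by rw [div_lt_one] <;> linarith
  obtain ⟨ε, hε, hexp⟩ : ∃ ε, 0 < ε ∧ 1 / (τ - 1) + ε = -ε + 1 :=
    ⟨(1 - 1 / (τ - 1)) / 2, by linarith, by ring⟩
  filter_upwards [h.le_rpow ε hε, (tendsto_natCast_atTop_atTop.comp hS).eventually
    ((tendsto_rpow_neg_atTop hε).eventually_le_const hη)] with n hle hsmall i hi
  calc w n i ≤ ((S n).card : ℝ) ^ (-ε + 1) := hexp ▸ hle i hi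
    _ = ((S n).card : ℝ) ^ (-ε) * (S n).card := by
        refine Real.rpow_add_one' (Nat.cast_nonneg _) (ne_of_gt ?_)
        rw [← hexp]
        have : 0 < 1 / (τ - 1) := one_div_pos.2 (by linarith)
        positivity
    _ ≤ η * (S n).card := mul_le_mul_of_nonneg_right hsmall (Nat.cast_nonneg _)

end PowerLawWeights

theorem rpow_mul_sum_heavy_le {n : ℕ} {w : Fin n → ℝ} (hw : ∀ i, 0 < w i) (U : Finset (Fin n))
    {t δ : ℝ} (ht : 0 ≤ t) (hδ : 0 ≤ δ) :
    t ^ δ * ∑ a ∈ heavy w U t, w a ≤ ∑ a ∈ U, w a ^ (1 + δ) := by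
  rw [Finset.mul_sum]
  refine (Finset.sum_le_sum fun a ha => ?_).trans (Finset.sum_le_sum_of_subset_of_nonneg
    (Finset.filter_subset _ U) fun a _ _ => Real.rpow_nonneg (hw a).le _)
  rw [Real.rpow_one_add' (hw a).le (by positivity), mul_comm]
  exact mul_le_mul_of_nonneg_left (Real.rpow_le_rpow ht (Finset.mem_filter.1 ha).2 hδ) (hw a).le

/-- Up to the truncation level `S n` has at least of order `log |S n|` vertices of weight `≥ t`;
beyond it, the moment of order `1 + δ` already makes the sum smaller by a factor `log |S n|`. -/
theorem PowerLawWeights.exists_log_mul_sum_heavy_le {τ C w₀ : ℝ} {S V : (n : ℕ) → Finset (Fin n)}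
    {w : (n : ℕ) → Fin n → ℝ} (h : PowerLawWeights τ C w₀ S w) (hV : PowerLawWeights τ C w₀ V w)
    (hS_top : Tendsto (fun n => (S n).card) atTop atTop)
    (hV_top : Tendsto (fun n => (V n).card) atTop atTop) (hτ : 2 < τ) (hC : 0 < C) (hw₀ : 0 < w₀)
    (hw : ∀ n i, 0 < w n i) :
    ∃ K : ℝ, 0 ≤ K ∧ ∀ᶠ n in atTop, ∀ t, w₀ ≤ t → (heavy (w n) (S n) t).Nonempty →
      Real.log (S n).card * ∑ a ∈ heavy (w n) (V n) t, w n a ≤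
        K * (V n).card * (heavy (w n) (S n) t).card := by
  have hτ₁ : 1 < τ := one_lt_two.trans hτ
  obtain ⟨δ, hδ₀, hδ⟩ := exists_between (sub_pos.2 hτ)
  obtain ⟨M₁, hM₁, hsum₁⟩ :=
    hV.exists_sum_rpow_le hV_top hτ₁ hC.le hw₀ hw one_pos (by linarith)
  obtain ⟨M₂, hM₂, hsum₂⟩ :=
    hV.exists_sum_rpow_le hV_top hτ₁ hC.le hw₀ hw (s := 1 + δ) (by linarith) (by linarith)
  have hSR := tendsto_natCast_atTop_atTop (R := ℝ).comp hS_top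
  refine ⟨2 / C * M₁ + M₂, by positivity, ?_⟩
  filter_upwards [hsum₁, hsum₂, h.eventually_mul_log_le_card_heavy hS_top hτ.le hC hw₀,
    hSR.eventually (eventually_log_le_truncation_rpow hτ₁ hδ₀),
    hSR.eventually ((tendsto_truncation hτ₁).eventually_ge_atTop 0)]
    with n hn₁ hn₂ hheavy hlog htr t ht hne
  simp only [Function.comp_apply, Real.rpow_one] at hn₁ hlog htr
  have hcard : (1 : ℝ) ≤ (heavy (w n) (S n) t).card := by exact_mod_cast hne.card_pos
  have hsum₀ : 0 ≤ ∑ a ∈ heavy (w n) (V n) t, w n a := Finset.sum_nonneg fun i _ => (hw n i).le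
  obtain htL | htL := le_total t (truncation τ (S n).card)
  · calc Real.log (S n).card * ∑ a ∈ heavy (w n) (V n) t, w n a
        ≤ 2 / C * (heavy (w n) (S n) t).card * (M₁ * (V n).card) := by
          refine mul_le_mul ?_ ((Finset.sum_le_sum_of_subset_of_nonneg (Finset.filter_subset _ _)
            fun i _ _ => (hw n i).le).trans hn₁) hsum₀ (by positivity)
          rw [div_mul_eq_mul_div, le_div_iff₀ hC]
          linarith [hheavy t ht htL]
      _ = 2 / C * M₁ * (V n).card * (heavy (w n) (S n) t).card := by ring
      _ ≤ _ := by gcongr; exact le_add_of_nonneg_right hM₂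
  · calc Real.log (S n).card * ∑ a ∈ heavy (w n) (V n) t, w n a
        ≤ t ^ δ * ∑ a ∈ heavy (w n) (V n) t, w n a :=
          mul_le_mul_of_nonneg_right (hlog.trans (Real.rpow_le_rpow htr htL hδ₀.le)) hsum₀
      _ ≤ M₂ * (V n).card * 1 := by
          rw [mul_one]
          exact (rpow_mul_sum_heavy_le (hw n) _ (hw₀.le.trans ht) hδ₀.le).trans hn₂
      _ ≤ _ := by gcongr; exact le_add_of_nonneg_left (by positivity)

/-! ### Expected risk -/

section Risk

theorem integral_card_filter {Ω ι : Type*} [MeasurableSpace Ω] {P : Measure Ω} [IsFiniteMeasure P]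
    {E : ι → Set Ω} (hE : ∀ i, MeasurableSet (E i)) (U : Finset ι)
    [∀ ω, DecidablePred fun i => ω ∈ E i] :
    ∫ ω, ((U.filter fun i => ω ∈ E i).card : ℝ) ∂P = ∑ i ∈ U, P.real (E i) := by
  have hcard (ω : Ω) : ((U.filter fun i => ω ∈ E i).card : ℝ) =
      ∑ i ∈ U, (E i).indicator (fun _ => (1 : ℝ)) ω := by
    simp only [Finset.natCast_card_filter, Set.indicator_apply]
  simp only [hcard]
  rw [integral_finsetSum _ fun i _ => (integrable_const 1).indicator (hE i)]
  simp only [integral_indicator_const _ (hE _), smul_eq_mul, mul_one]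

theorem risk_eq (d : ℕ) (τ w₀ : ℝ) (γ : ℝ≥0∞) {n : ℕ} (k : ℕ) (w : Fin n → ℝ) (t : ℝ) :
    risk d τ w₀ γ k w t =
      (∑ a ∈ heavy w (community n k) t, volume.real (detected d τ w₀ γ k w a)ᶜ +
        ∑ a ∈ heavy w (community n k)ᶜ t, volume.real (detected d τ w₀ γ k w a)) /
      (2 * (heavy w (community n k) t).card) := by
  classical
  let E (a : Fin n) : Set (Sample d n) :=
    if a ∈ community n k then (detected d τ w₀ γ k w a)ᶜ else detected d τ w₀ γ k w a
  have hE (a : Fin n) : MeasurableSet (E a) := by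
    have := measurableSet_detected (d := d) (τ := τ) (w₀ := w₀) (γ := γ) (k := k) (w := w) a
    by_cases ha : a ∈ community n k <;> simp [E, ha, this]
  have hsymm (ω : Sample d n) :
      symmDiff (heavy w (estimatedCommunity w (randomGraph d τ w₀ γ k w ω)) t)
        (heavy w (community n k) t) = (heavy w Finset.univ t).filter fun a => ω ∈ E a := by
    ext a
    by_cases ha : a ∈ community n k <;> by_cases hat : t ≤ w a <;>
      simp [E, ha, hat, heavy, estimatedCommunity, mem_detected, Finset.mem_symmDiff]
  simp only [risk, hsymm]
  rw [integral_div, integral_card_filter hE]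
  congr 1
  simp only [heavy, Finset.sum_filter]
  rw [← Finset.sum_add_sum_compl (community n k)]
  congr 1 <;> refine Finset.sum_congr rfl fun a ha => ?_
  · simp only [E, if_pos ha]
  · simp only [E, if_neg (Finset.mem_compl.1 ha)]

end Risk

section ErrorRates

variable {d : ℕ} {γ : ℝ≥0∞} {τ C w₀ : ℝ} {k : ℕ → ℕ} {w : (n : ℕ) → Fin n → ℝ}

theorem tendsto_card_community (hk : ∀ᶠ n in atTop, k n ≤ n) (hk_top : Tendsto k atTop atTop) :
    Tendsto (fun n => (community n (k n)).card) atTop atTop :=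
  hk_top.congr' (hk.mono fun _ hn => (card_community hn).symm)

theorem tendsto_sqrt_log : Tendsto (fun n : ℕ => √(Real.log n)) atTop atTop :=
  Real.tendsto_sqrt_atTop.comp (Real.tendsto_log_atTop.comp tendsto_natCast_atTop_atTop)

theorem exists_measureReal_compl_detected_le (hd : d ≠ 0) (γ : ℝ≥0∞) (hτ : 2 < τ) (hC : 0 < C)
    (hw₀ : 0 < w₀) (hw : ∀ n i, 0 < w n i) (hk : ∀ᶠ n in atTop, k n ≤ n)
    (hk_top : Tendsto k atTop atTop) (h : PowerLawWeights τ C w₀ (fun n => community n (k n)) w) :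
    ∃ K : ℝ, 0 ≤ K ∧ ∀ᶠ n in atTop, ∀ a ∈ community n (k n), 2 * w₀ < w n a →
      volume.real (detected d τ w₀ γ (k n) (w n) a)ᶜ ≤ K / w n a := by
  have hμ := meanWeight_pos hτ hw₀
  have hγ := retention_pos d γ
  have hS := tendsto_card_community hk hk_top
  obtain ⟨c, hc, hpair⟩ := h.exists_isLightPair hS (by linarith) hC hw₀
  refine ⟨(8 * meanWeight τ w₀ / (c * w₀) + 4 * meanWeight τ w₀ ^ 2 / (c ^ 2 * w₀ ^ 3)) /
    retention d γ ^ 6, by positivity, ?_⟩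
  filter_upwards [hk, eventually_gt_atTop 1, hpair, (tendsto_sqrt_log.const_div_atTop
      ((2 * w₀) ^ 2)).eventually_le_const (by positivity :
        0 < c ^ 2 * w₀ ^ 3 * retention d γ ^ 3 / (2 * meanWeight τ w₀ ^ 2)),
    h.eventually_le_mul_card hS hτ (by positivity : 0 < meanWeight τ w₀ / w₀)]
    with n hkn hn hpn hthr hle a ha hwa
  obtain ⟨N, B₁, B₂, hN, hB⟩ := hpn a hwa
  rw [card_community hkn] at hN hle
  refine measureReal_compl_detected_le hd hμ hw₀ (hw n) hn ha (by linarith) hB hc hN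
    (div_le_one_of_le₀ ?_ (by positivity)) hthr
  have := hle a ha
  rwa [div_mul_eq_mul_div, le_div_iff₀ hw₀] at this

theorem sum_measureReal_detected_le (hd : d ≠ 0) (hγ : 1 < γ) (hμ : 0 < meanWeight τ w₀) {n k : ℕ}
    (hn : 1 < n) (hkn : k ≤ n) {w : Fin n → ℝ} (hw : ∀ i, 0 < w i) {M : ℝ}
    (hV : ∑ i, w i ≤ M * n) (hVC : ∑ i ∈ community n k, w i ≤ M * k) (t : ℝ) :
    ∑ a ∈ heavy w (community n k)ᶜ t, volume.real (detected d τ w₀ γ k w a) ≤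
      2 * M ^ 2 / meanWeight τ w₀ ^ 3 * (√(Real.log n) / n) * ∑ a ∈ heavy w Finset.univ t, w a := by
  rw [Finset.mul_sum]
  calc ∑ a ∈ heavy w (community n k)ᶜ t, volume.real (detected d τ w₀ γ k w a)
      ≤ ∑ a ∈ heavy w (community n k)ᶜ t,
          2 * M ^ 2 / meanWeight τ w₀ ^ 3 * (√(Real.log n) / n) * w a :=
        Finset.sum_le_sum fun a ha => (measureReal_detected_le_of_notMem hd hγ hμ hn hkn hw hV hVC
          (Finset.mem_compl.1 (Finset.mem_filter.1 ha).1)).trans_eq (by ring)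
    _ ≤ _ := Finset.sum_le_sum_of_subset_of_nonneg
        (Finset.filter_subset_filter _ (Finset.subset_univ _)) fun a _ _ => by
          have := hw a
          positivity

theorem exists_sum_measureReal_detected_le (hd : d ≠ 0) (hγ : 1 < γ) (hτ : 2 < τ) (hC : 0 < C)
    (hw₀ : 0 < w₀) (hw : ∀ n i, 0 < w n i) (hk : ∀ᶠ n in atTop, k n ≤ n)
    (hk_top : Tendsto k atTop atTop)
    (hlog : (fun n : ℕ => Real.log n) =O[atTop] fun n => Real.log (k n))
    (hV : PowerLawWeights τ C w₀ (fun _ => Finset.univ) w)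
    (hVC : PowerLawWeights τ C w₀ (fun n => community n (k n)) w) :
    ∃ K : ℝ, 0 ≤ K ∧ ∀ᶠ n in atTop, ∀ t, w₀ ≤ t → (heavy (w n) (community n (k n)) t).Nonempty →
      ∑ a ∈ heavy (w n) (community n (k n))ᶜ t, volume.real (detected d τ w₀ γ (k n) (w n) a) ≤
        K / √(Real.log n) * (heavy (w n) (community n (k n)) t).card := by
  have hμ := meanWeight_pos hτ hw₀
  have hτ₁ : 1 < τ - 1 := by linarith
  have hS := tendsto_card_community hk hk_top
  have hU : Tendsto (fun n => (Finset.univ : Finset (Fin n)).card) atTop atTop :=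
    tendsto_id.congr fun n => (Finset.card_fin n).symm
  obtain ⟨M₁, -, hsum₁⟩ := hV.exists_sum_rpow_le hU (by linarith) hC.le hw₀ hw one_pos hτ₁
  obtain ⟨M₂, -, hsum₂⟩ := hVC.exists_sum_rpow_le hS (by linarith) hC.le hw₀ hw one_pos hτ₁
  obtain ⟨K, hK, hheavy⟩ := hVC.exists_log_mul_sum_heavy_le hV hS hU hτ hC hw₀ hw
  obtain ⟨c, hc, hlogc⟩ := hlog.exists_nonneg
  set A := 2 * max M₁ M₂ ^ 2 / meanWeight τ w₀ ^ 3
  refine ⟨A * (c * K), by positivity, ?_⟩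
  filter_upwards [hk, eventually_gt_atTop 1, hsum₁, hsum₂, hheavy, hlogc.bound]
    with n hkn hn hn₁ hn₂ hheavy hlogn t ht hne
  simp only [Real.rpow_one, card_community hkn, Finset.card_fin] at hn₁ hn₂ hheavy
  rw [Real.norm_of_nonneg (Real.log_natCast_nonneg _),
    Real.norm_of_nonneg (Real.log_natCast_nonneg _)] at hlogn
  have hL : 0 < Real.log n := Real.log_pos (mod_cast hn)
  calc ∑ a ∈ heavy (w n) (community n (k n))ᶜ t, volume.real (detected d τ w₀ γ (k n) (w n) a)
      ≤ A * (√(Real.log n) / n) * ∑ a ∈ heavy (w n) Finset.univ t, w n a :=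
        sum_measureReal_detected_le hd hγ hμ hn hkn (hw n)
          (hn₁.trans (by gcongr; exact le_max_left _ _))
          (hn₂.trans (by gcongr; exact le_max_right _ _)) t
    _ ≤ A * (√(Real.log n) / n) *
          (c * K * n * (heavy (w n) (community n (k n)) t).card / Real.log n) := by
        refine mul_le_mul_of_nonneg_left ((le_div_iff₀' hL).2 ?_) (by positivity)
        calc Real.log n * ∑ a ∈ heavy (w n) Finset.univ t, w n a
            ≤ c * Real.log (k n) * ∑ a ∈ heavy (w n) Finset.univ t, w n a :=
              mul_le_mul_of_nonneg_right hlogn (Finset.sum_nonneg fun a _ => (hw n a).le)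
          _ ≤ c * (K * n * (heavy (w n) (community n (k n)) t).card) := by
              rw [mul_assoc]
              exact mul_le_mul_of_nonneg_left (hheavy t ht hne) hc
          _ = c * K * n * (heavy (w n) (community n (k n)) t).card := by ring
    _ = A * (c * K) * (√(Real.log n) / Real.log n) *
          (heavy (w n) (community n (k n)) t).card := by field
    _ = _ := by rw [Real.sqrt_div_self', mul_one_div]

end ErrorRates

/-! ### Community size and threshold -/

section Thresholds

variable {τ : ℝ} {k : ℕ → ℕ} {t : ℕ → ℝ}

theorem tendsto_of_log_isBigO_log
    (h : (fun n : ℕ => Real.log n) =O[atTop] fun n => Real.log (k n)) : Tendsto k atTop atTop := by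
  obtain ⟨c, hc, hbound⟩ := h.exists_pos
  have hck : Tendsto (fun n => c * (k n : ℝ)) atTop atTop := by
    refine tendsto_atTop_mono' _ ?_ (Real.tendsto_log_atTop.comp tendsto_natCast_atTop_atTop)
    filter_upwards [hbound.bound] with n hn
    rw [Real.norm_of_nonneg (by positivity), Real.norm_of_nonneg (by positivity)] at hn
    exact hn.trans (mul_le_mul_of_nonneg_left (Real.log_le_self (Nat.cast_nonneg _)) hc.le)
  exact tendsto_natCast_atTop_iff.1 ((tendsto_const_mul_atTop_of_pos hc).1 hck)

theorem le_pow_three_of_rpow_le_rpow (hτ : 2 ≤ τ) {n k : ℕ} (hn : 1 ≤ Real.log n) (hk : 1 ≤ k)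
    (h : (n * Real.log n / k) ^ (1 / τ) ≤ (k : ℝ) ^ (1 / (τ - 1))) : n ≤ k ^ 3 := by
  have hk' : (1 : ℝ) ≤ k := mod_cast hk
  have hexp : 1 / (τ - 1) * τ ≤ 2 := by
    rw [one_div_mul_eq_div, div_le_iff₀] <;> linarith
  have hle : n * Real.log n / k ≤ (k : ℝ) ^ 2 :=
    calc n * Real.log n / k
        = ((n * Real.log n / k) ^ (1 / τ)) ^ τ := by
          rw [← Real.rpow_mul (by positivity), one_div_mul_cancel (by linarith), Real.rpow_one]
      _ ≤ ((k : ℝ) ^ (1 / (τ - 1))) ^ τ := Real.rpow_le_rpow (by positivity) h (by linarith)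
      _ = (k : ℝ) ^ (1 / (τ - 1) * τ) := (Real.rpow_mul (by positivity) _ _).symm
      _ ≤ (k : ℝ) ^ (2 : ℝ) := Real.rpow_le_rpow_of_exponent_le hk' hexp
      _ = (k : ℝ) ^ 2 := Real.rpow_two _
  rw [div_le_iff₀ (by positivity), ← pow_succ] at hle
  exact_mod_cast (le_mul_of_one_le_right n.cast_nonneg hn).trans hle

theorem log_isBigO_log_of_rpow_isLittleO (hτ : 2 ≤ τ) (hk : ∀ᶠ n in atTop, 1 ≤ k n)
    (h : (fun n : ℕ => (n * Real.log n / k n) ^ (1 / τ)) =o[atTop]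
      fun n => (k n : ℝ) ^ (1 / (τ - 1))) :
    (fun n : ℕ => Real.log n) =O[atTop] fun n => Real.log (k n) := by
  refine .of_bound 3 ?_
  filter_upwards [hk, h.bound one_pos, eventually_ge_atTop 1, (Real.tendsto_log_atTop.comp
    tendsto_natCast_atTop_atTop).eventually_ge_atTop 1] with n hkn hbound hn hlog
  rw [Function.comp_apply] at hlog
  rw [one_mul, Real.norm_of_nonneg (by positivity), Real.norm_of_nonneg (by positivity)] at hbound
  rw [Real.norm_of_nonneg (by positivity), Real.norm_of_nonneg (by positivity)]
  calc Real.log n ≤ Real.log ((k n : ℝ) ^ 3) :=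
        Real.log_le_log (by positivity) (mod_cast le_pow_three_of_rpow_le_rpow hτ hlog hkn hbound)
    _ = 3 * Real.log (k n) := by rw [Real.log_pow]; norm_num

theorem tendsto_threshold (hτ : 0 < τ) (hk : ∀ᶠ n in atTop, 1 ≤ k n ∧ k n ≤ n)
    (ht : ∀ᶠ n in atTop, 0 < t n)
    (h : (fun n : ℕ => (n * Real.log n / k n) ^ (1 / τ)) =o[atTop] t) : Tendsto t atTop atTop := by
  have hlog : Tendsto (fun n : ℕ => Real.log n ^ (1 / τ)) atTop atTop :=
    (tendsto_rpow_atTop (by positivity)).comp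
      (Real.tendsto_log_atTop.comp tendsto_natCast_atTop_atTop)
  refine tendsto_atTop_mono' _ ?_ hlog
  filter_upwards [hk, ht, h.bound one_pos] with n ⟨hk₁, hkn⟩ htn hbound
  rw [one_mul, Real.norm_of_nonneg (by positivity), Real.norm_of_nonneg htn.le] at hbound
  refine (Real.rpow_le_rpow (by positivity) ?_ (by positivity)).trans hbound
  rw [le_div_iff₀ (by positivity), mul_comm]
  gcongr

end Thresholds

end GeomCommunity

open GeomCommunity in
theorem theorem3p2_general {d : ℕ} (hd : d ≠ 0) {γ : ℝ≥0∞} (hγ : 1 < γ) {τ C w₀ : ℝ} (hτ : 2 < τ)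
    (hC : 0 < C) (hw₀ : 0 < w₀) {k : ℕ → ℕ} {w : (n : ℕ) → Fin n → ℝ} {t : ℕ → ℝ}
    (hk : ∀ᶠ n in atTop, k n ≤ n) (hw : ∀ n i, 0 < w n i)
    (hV : PowerLawWeights τ C w₀ (fun _ => Finset.univ) w)
    (hVC : PowerLawWeights τ C w₀ (fun n => community n (k n)) w)
    (hlog : (fun n : ℕ => Real.log n) =O[atTop] fun n => Real.log (k n))
    (ht : Tendsto t atTop atTop) :
    Tendsto (fun n => risk d τ w₀ γ (k n) (w n) (t n))
      (atTop ⊓ 𝓟 {n | (heavy (w n) (community n (k n)) (t n)).Nonempty}) (𝓝 0) := by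
  have hk_top := tendsto_of_log_isBigO_log hlog
  obtain ⟨K₁, hK₁, hin⟩ :=
    exists_measureReal_compl_detected_le hd γ hτ hC hw₀ hw hk hk_top hVC
  obtain ⟨K₂, -, hout⟩ :=
    exists_sum_measureReal_detected_le hd hγ hτ hC hw₀ hw hk hk_top hlog hV hVC
  have hlim : Tendsto (fun n : ℕ => (K₁ / t n + K₂ / √(Real.log n)) / 2) atTop (𝓝 0) := by
    simpa only [add_zero, zero_div] using ((ht.const_div_atTop K₁).add
      (tendsto_sqrt_log.const_div_atTop K₂)).div_const 2
  refine tendsto_of_tendsto_of_tendsto_of_le_of_le' tendsto_const_nhds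
    (hlim.mono_left inf_le_left) (.of_forall fun n => integral_nonneg fun ω => by positivity) ?_
  rw [eventually_inf_principal]
  filter_upwards [hin, hout, ht.eventually_gt_atTop (2 * w₀)] with n hin hout htn hne
  have : (0 : ℝ) < (heavy (w n) (community n (k n)) (t n)).card := mod_cast hne.card_pos
  rw [risk_eq, div_le_iff₀ (by positivity)]
  refine (add_le_add (Finset.sum_le_card_nsmul _ _ (K₁ / t n) fun a ha => ?_)
    (hout (t n) (by linarith) hne)).trans_eq (by rw [nsmul_eq_mul]; ring)
  obtain ⟨haC, hat⟩ := Finset.mem_filter.1 ha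
  exact (hin a haC (htn.trans_le hat)).trans
    (div_le_div_of_nonneg_left hK₁ (by linarith) hat)

theorem theorem3p2
    -- the fixed parameters of the model
    (d : ℕ) (hd : 1 ≤ d) (γ : ℝ≥0∞) (hγ : 1 < γ)
    (τ C w₀ : ℝ) (hτ : 2 < τ ∧ τ < 3) (hC : 0 < C) (hw₀ : 0 < w₀)
    -- the community sizes, the weight sequences and the thresholds
    (k : ℕ → ℕ) (w : (n : ℕ) → Fin n → ℝ) (t : ℕ → ℝ)
    (hk : ∀ᶠ n in atTop, 1 ≤ k n ∧ k n ≤ n)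
    (hw : ∀ n i, 0 < w n i)
    (ht : ∀ᶠ n in atTop, 0 < t n)
    -- power-law tail of the weights of all the vertices
    (hF : ∀ ε : ℝ, 0 < ε → ∀ᶠ n : ℕ in atTop, ∀ x : ℝ, w₀ ≤ x →
      x ≤ (n : ℝ) ^ (1 / (τ - 1)) / Real.log n →
      |1 - GeomCommunity.empCDF Finset.univ (w n) x - C * x ^ (1 - τ)| ≤ ε * (C * x ^ (1 - τ)))
    -- power-law tail of the weights in the community
    (hFk : ∀ K : ℝ, 0 < K → ∀ ε : ℝ, 0 < ε → ∀ᶠ n : ℕ in atTop, ∀ x : ℝ, w₀ ≤ x →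
      x ≤ K * ((k n : ℝ) ^ (1 / (τ - 1)) / Real.log (k n)) →
      |1 - GeomCommunity.empCDF (GeomCommunity.community n (k n)) (w n) x - C * x ^ (1 - τ)|
        ≤ ε * (C * x ^ (1 - τ)))
    -- the largest weights are at most `n ^ (1/(τ-1) + o(1))` and `k ^ (1/(τ-1) + o(1))`
    (hmax : ∀ ε : ℝ, 0 < ε → ∀ᶠ n : ℕ in atTop, ∀ i : Fin n,
      w n i ≤ (n : ℝ) ^ (1 / (τ - 1) + ε))
    (hmaxk : ∀ ε : ℝ, 0 < ε → ∀ᶠ n : ℕ in atTop, ∀ i ∈ GeomCommunity.community n (k n),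
      w n i ≤ (k n : ℝ) ^ (1 / (τ - 1) + ε))
    -- `(n log n / k) ^ (1/τ) ≪ t_n ≪ k ^ (1/(τ-1))`
    (ht_low : (fun n : ℕ => ((n : ℝ) * Real.log n / k n) ^ (1 / τ)) =o[atTop] t)
    (ht_high : t =o[atTop] fun n : ℕ => (k n : ℝ) ^ (1 / (τ - 1))) :
    Tendsto (fun n => GeomCommunity.risk d τ w₀ γ (k n) (w n) (t n))
      (atTop ⊓ 𝓟 {n | (GeomCommunity.heavy (w n)
        (GeomCommunity.community n (k n)) (t n)).Nonempty}) (𝓝 0) := by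
  have hτ₁ : 2 < τ := hτ.1
  refine theorem3p2_general (by lia) hγ hτ₁ hC hw₀ (hk.mono fun n h => h.2) hw
    (.of_card_eq (.of_forall Finset.card_fin) hF
      fun ε hε => (hmax ε hε).mono fun n h i _ => h i)
    (.of_card_eq (hk.mono fun n h => GeomCommunity.card_community h.2)
      (fun ε hε => by
        simpa only [one_mul, GeomCommunity.truncation] using hFk 1 one_pos ε hε) hmaxk)
    (GeomCommunity.log_isBigO_log_of_rpow_isLittleO hτ₁.le (hk.mono fun n h => h.1)
      (ht_low.trans ht_high))
    (GeomCommunity.tendsto_threshold (by linarith) hk ht ht_low)
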